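/- Let $D\neq 0$ be an integer with $D\equiv 0$ or $1 \pmod 4$, let $S=S(D)=\mathbb Z[\tau]$ be the quadratic ring of discriminant $D$ (with $\tau^2=\frac D4$, resp. $\tau^2=\tau+\frac{D-1}4$), and let $K=S\otimes\mathbb Q$. Let $\mathrm{Cl}^+(S)$ be the narrow class group in the sense of oriented ideals: the group of pairs $(I,\varepsilon)$, with $I\subset K$ an invertible fractional ideal of $S$ and $\varepsilon=\pm1$, modulo the subgroup of pairs $(\kappa S,\operatorname{sgn}N(\kappa))$, $\kappa\in K^\times$. The norm of $(I,\varepsilon)$ is the determinant with respect to $(1,\tau)$ of any $\mathbb Z$-basis of $I$ for which this determinant has sign $\varepsilon$ (an oriented basis). A triple of invertible oriented ideals $(I_S,I_T,I_U)$ is balanced if $I_SI_TI_U\subseteq S$ and the product of the three norms is $1$. A charge cube is an array $a=(a_{ABC})_{A,B,C\in\{0,1\}}$ of integers, with quartic norm $\Delta(a)=-\mathrm{Det}\,a$, where $\mathrm{Det}$ is Cayley's hyperdeterminant. Write $a_0,\dots,a_7$ for the entries via $ABC\mapsto 4A+2B+C$. The cube is projective if the three binary quadratic forms $$f_S=(a_0a_3-a_1a_2)x^2+(a_0a_7-a_1a_6+a_4a_3-a_5a_2)xy+(a_4a_7-a_5a_6)y^2,$$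 $$f_T=(a_0a_5-a_4a_1)x^2+(a_0a_7-a_4a_3+a_2a_5-a_6a_1)xy+(a_2a_7-a_6a_3)y^2,$$ $$f_U=(a_0a_6-a_2a_4)x^2+(a_0a_7-a_2a_5+a_1a_6-a_3a_4)xy+(a_1a_7-a_3a_5)y^2$$ are primitive. Let $\mathcal C_D$ be the set of $\mathrm{SL}(2,\mathbb Z)^3$-equivalence (U-duality) classes of projective cubes with $\Delta=-D$. A cube $a$ corresponds to a balanced triple $(I_S,I_T,I_U)$ if, for suitable oriented bases $\alpha,\beta,\gamma$ of the three ideals, $\alpha_A\beta_B\gamma_C=c_{ABC}+a_{ABC}\tau$ with $c_{ABC}\in\mathbb Z$. 1. Every projective cube with $\Delta=-D$ corresponds to a balanced triple of invertible oriented ideals, and every such triple corresponds to such a cube. There are an abelian group structure on $\mathcal C_D$ and a group isomorphism $$\mathcal C_D\;\cong\;\mathrm{Cl}^+(S(D))\times\mathrm{Cl}^+(S(D))$$ sending $[a]$ to $([I_S],[I_T])$ whenever $a$ corresponds to $(I_S,I_T,I_U)$; in that case $[I_U]=([I_S][I_T])^{-1}$. The product is the multiplication of balanced triples, $(I_S,I_T,I_U)\circ(I_S',I_T',I_U')=(I_SI_S',I_TI_T',I_UI_U')$,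 and the identity is the class of $|001\rangle+|010\rangle+|100\rangle+\frac D4|111\rangle$ if $D\equiv0\pmod 4$, and of $|001\rangle+|010\rangle+|100\rangle+|110\rangle+|101\rangle+|011\rangle+\frac{D+3}4|111\rangle$ if $D\equiv1\pmod 4$. 2. Hence $\mathcal C_D$ is finite and $n_D^{\mathrm{proj}}:=|\mathcal C_D|=|\mathrm{Cl}^+(S(D))|^2$. 3. If $D<0$, let $\mathrm{Cl}(S(D))$ be the ordinary ideal class group. Then $|\mathrm{Cl}^+(S(D))|=2\,|\mathrm{Cl}(S(D))|$ and $n_D^{\mathrm{proj}}=4\,|\mathrm{Cl}(S(D))|^2$. More precisely, for each projective cube with $\Delta=-D$ the forms $f_S,f_T,f_U$ are definite with product of signs $-1$, and for each of the four admissible sign patterns exactly $|\mathrm{Cl}(S(D))|^2$ of the classes in $\mathcal C_D$ have that pattern. -/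

import Mathlib

open scoped MatrixGroups

noncomputable section

/-! ## Integral binary quadratic forms -/

/-- The integral binary quadratic form `a x² + b x y + c y²`. -/
structure BinForm where
  a : ℤ
  b : ℤ
  c : ℤ

namespace BinForm

def eval (f : BinForm) (x y : ℤ) : ℤ := f.a * x ^ 2 + f.b * x * y + f.c * y ^ 2

/-- `gcd (a, b, c) = 1`. -/
def IsPrimitive (f : BinForm) : Prop := Int.gcd (Int.gcd f.a f.b) f.c = 1

/-- `f` is definite of sign `s`: positive definite for `s = 1`, negative definite for `s = -1`. -/
def IsDefinite (f : BinForm) (s : ℤˣ) : Prop :=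
  ∀ x y : ℤ, (x, y) ≠ (0, 0) → 0 < (s : ℤ) * f.eval x y

end BinForm

/-! ## Charge cubes -/

/-- Elements `a_{ABC}` of `ℤ² ⊗ ℤ² ⊗ ℤ²`. -/
@[ext]
structure ChargeCube where
  coeff : Fin 2 → Fin 2 → Fin 2 → ℤ

namespace ChargeCube

/-- Cayley's hyperdeterminant. -/
def hyperdet (q : ChargeCube) : ℤ :=
  let a := q.coeff
  a 0 0 0 ^ 2 * a 1 1 1 ^ 2 + a 0 0 1 ^ 2 * a 1 1 0 ^ 2
    + a 0 1 0 ^ 2 * a 1 0 1 ^ 2 + a 1 0 0 ^ 2 * a 0 1 1 ^ 2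
    - 2 * (a 0 0 0 * a 0 0 1 * a 1 1 0 * a 1 1 1 + a 0 0 0 * a 0 1 0 * a 1 0 1 * a 1 1 1
      + a 0 0 0 * a 1 0 0 * a 0 1 1 * a 1 1 1 + a 0 0 1 * a 0 1 0 * a 1 0 1 * a 1 1 0
      + a 0 0 1 * a 1 0 0 * a 0 1 1 * a 1 1 0 + a 0 1 0 * a 1 0 0 * a 0 1 1 * a 1 0 1)
    + 4 * (a 0 0 0 * a 0 1 1 * a 1 0 1 * a 1 1 0 + a 0 0 1 * a 0 1 0 * a 1 0 0 * a 1 1 1)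

/-- The quartic norm `Δ = - Det a`. -/
def quarticNorm (q : ChargeCube) : ℤ := -q.hyperdet

def formS (q : ChargeCube) : BinForm :=
  let a := q.coeff
  ⟨a 0 0 0 * a 0 1 1 - a 0 0 1 * a 0 1 0,
   a 0 0 0 * a 1 1 1 - a 0 0 1 * a 1 1 0 + a 1 0 0 * a 0 1 1 - a 1 0 1 * a 0 1 0,
   a 1 0 0 * a 1 1 1 - a 1 0 1 * a 1 1 0⟩

def formT (q : ChargeCube) : BinForm :=
  let a := q.coeff
  ⟨a 0 0 0 * a 1 0 1 - a 1 0 0 * a 0 0 1,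
   a 0 0 0 * a 1 1 1 - a 1 0 0 * a 0 1 1 + a 0 1 0 * a 1 0 1 - a 1 1 0 * a 0 0 1,
   a 0 1 0 * a 1 1 1 - a 1 1 0 * a 0 1 1⟩

def formU (q : ChargeCube) : BinForm :=
  let a := q.coeff
  ⟨a 0 0 0 * a 1 1 0 - a 0 1 0 * a 1 0 0,
   a 0 0 0 * a 1 1 1 - a 0 1 0 * a 1 0 1 + a 0 0 1 * a 1 1 0 - a 0 1 1 * a 1 0 0,
   a 0 0 1 * a 1 1 1 - a 0 1 1 * a 1 0 1⟩

/-- A cube is projective if its three binary quadratic forms are primitive. -/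
def IsProjective (q : ChargeCube) : Prop :=
  q.formS.IsPrimitive ∧ q.formT.IsPrimitive ∧ q.formU.IsPrimitive

end ChargeCube

/-- The U-duality group `SL(2,ℤ) × SL(2,ℤ) × SL(2,ℤ)`. -/
abbrev UDuality : Type := SL(2, ℤ) × SL(2, ℤ) × SL(2, ℤ)

/-- `((g, h, k) • a)_{ABC} = ∑ g_{AA'} h_{BB'} k_{CC'} a_{A'B'C'}`. -/
instance : MulAction UDuality ChargeCube where
  smul g q := ⟨fun A B C => ∑ A' : Fin 2, ∑ B' : Fin 2, ∑ C' : Fin 2,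
    g.1 A A' * g.2.1 B B' * g.2.2 C C' * q.coeff A' B' C'⟩
  one_smul q := by
    ext A B C
    change (∑ A' : Fin 2, ∑ B' : Fin 2, ∑ C' : Fin 2,
      (1 : SL(2, ℤ)) A A' * (1 : SL(2, ℤ)) B B' * (1 : SL(2, ℤ)) C C' * q.coeff A' B' C') = _
    fin_cases A <;> fin_cases B <;> fin_cases C <;> simp
  mul_smul g h q := by
    ext A B C
    change (∑ A' : Fin 2, ∑ B' : Fin 2, ∑ C' : Fin 2,
      (g.1 * h.1) A A' * (g.2.1 * h.2.1) B B' * (g.2.2 * h.2.2) C C' * q.coeff A' B' C') =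
      ∑ A' : Fin 2, ∑ B' : Fin 2, ∑ C' : Fin 2, g.1 A A' * g.2.1 B B' * g.2.2 C C' *
        (∑ A₁ : Fin 2, ∑ B₁ : Fin 2, ∑ C₁ : Fin 2,
          h.1 A' A₁ * h.2.1 B' B₁ * h.2.2 C' C₁ * q.coeff A₁ B₁ C₁)
    simp only [Matrix.SpecialLinearGroup.coe_mul, Matrix.mul_apply, Fin.sum_univ_two]
    ring

/-- The projective cubes with quartic norm `Δ = -D`. -/
def ProjCube (D : ℤ) : Type := {q : ChargeCube // q.quarticNorm = -D ∧ q.IsProjective}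

/-- U-duality equivalence of projective cubes. -/
instance projCubeSetoid (D : ℤ) : Setoid (ProjCube D) :=
  (MulAction.orbitRel UDuality ChargeCube).comap Subtype.val

/-- The set of U-duality classes of projective cubes with quartic norm `-D`. -/
def CubeClass (D : ℤ) : Type := Quotient (projCubeSetoid D)

def CubeClass.mk {D : ℤ} (q : ProjCube D) : CubeClass D := Quotient.mk (projCubeSetoid D) q

/-- The cube `|001⟩ + |010⟩ + |100⟩ + (D/4)|111⟩` for `D ≡ 0 (mod 4)`, and
`|001⟩ + |010⟩ + |100⟩ + |110⟩ + |101⟩ + |011⟩ + ((D+3)/4)|111⟩` for `D ≡ 1 (mod 4)`. -/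
def idCube (D : ℤ) : ChargeCube :=
  ⟨fun A B C =>
    match A.val + B.val + C.val with
    | 0 => 0
    | 1 => 1
    | 2 => if D % 4 = 0 then 0 else 1
    | _ => if D % 4 = 0 then D / 4 else (D + 3) / 4⟩

/-! ## The quadratic ring of discriminant `D` and its class groups -/

/-- For `D ≡ 0, 1 (mod 4)`: the quadratic ring `S(D) = ℤ[τ]` of discriminant `D`, where
`τ² = D/4` if `D ≡ 0 (mod 4)` and `τ² = (D-1)/4 + τ` if `D ≡ 1 (mod 4)`. -/
abbrev QuadRing (D : ℤ) : Type := QuadraticAlgebra ℤ (D / 4) (D % 4)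

/-- `K = S(D) ⊗ ℚ`; an element `⟨x, y⟩` is `x + y τ`. -/
abbrev QuadAlg (D : ℤ) : Type :=
  QuadraticAlgebra ℚ ((D / 4 : ℤ) : ℚ) ((D % 4 : ℤ) : ℚ)

/-- The inclusion `S(D) → K`. -/
def quadRingIncl (D : ℤ) : QuadRing D →+* QuadAlg D where
  toFun z := ⟨z.re, z.im⟩
  map_one' := by ext <;> norm_num [QuadraticAlgebra.re_one, QuadraticAlgebra.im_one]
  map_mul' z w := by ext <;> simp
  map_zero' := by ext <;> simp
  map_add' z w := by ext <;> simp

instance (D : ℤ) : Algebra (QuadRing D) (QuadAlg D) := (quadRingIncl D).toAlgebra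

theorem quadRing_isDomain {D : ℤ} (hD : D % 4 = 0 ∨ D % 4 = 1) (hneg : D < 0) :
    IsDomain (QuadRing D) := by
  have key : ∀ z : QuadRing D, z.norm = 0 → z = 0 := by
    intro z hz
    rw [QuadraticAlgebra.norm_def] at hz
    have h4 : D = 4 * (D / 4) + D % 4 := by omega
    have h5 : (2 * z.re + (D % 4) * z.im) ^ 2 + (-D) * z.im ^ 2 = 0 := by
      have h6 : (D % 4) ^ 2 = D % 4 := by rcases hD with h | h <;> rw [h] <;> norm_num
      linear_combination 4 * hz + z.im ^ 2 * h6 - z.im ^ 2 * h4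
    have him : z.im = 0 := by
      by_contra h
      have : 0 < z.im ^ 2 := by positivity
      nlinarith [sq_nonneg (2 * z.re + (D % 4) * z.im)]
    have hre : z.re = 0 := by
      rw [him] at h5
      simpa using h5
    ext <;> simp [him, hre]
  have : NoZeroDivisors (QuadRing D) := ⟨fun {x y} h => by
    have h' : x.norm * y.norm = 0 := by rw [← map_mul, h]; simp
    rcases mul_eq_zero.mp h' with h | h
    · exact Or.inl (key _ h)
    · exact Or.inr (key _ h)⟩
  exact NoZeroDivisors.to_isDomain _

/-- Invertible oriented fractional ideals `(I, ε)` of `S(D)`: an invertible `S(D)`-submodule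
`I` of `K` (such a submodule is automatically a fractional ideal) with a sign `ε = ±1`. -/
def OrientedIdeal (D : ℤ) : Type := (Submodule (QuadRing D) (QuadAlg D))ˣ × SignTypeˣ

instance (D : ℤ) : CommGroup (OrientedIdeal D) :=
  inferInstanceAs (CommGroup ((Submodule (QuadRing D) (QuadAlg D))ˣ × SignTypeˣ))

/-- The underlying fractional ideal `I` of `(I, ε)`. -/
def OrientedIdeal.ideal {D : ℤ} (I : OrientedIdeal D) : Submodule (QuadRing D) (QuadAlg D) :=
  (I.1 : Submodule (QuadRing D) (QuadAlg D))

/-- The orientation `ε` of `(I, ε)`. -/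
def OrientedIdeal.orientation {D : ℤ} (I : OrientedIdeal D) : SignType := (I.2 : SignType)

/-- `κ ↦ (κ S(D), sgn N(κ))` for `κ` in `Kˣ`. -/
def principalOriented (D : ℤ) : (QuadAlg D)ˣ →* OrientedIdeal D where
  toFun κ :=
    (Units.map (Submodule.spanSingleton (QuadRing D)).toMonoidHom κ,
     Units.map (((signHom : ℚ →*₀ SignType) : ℚ →* SignType).comp QuadraticAlgebra.norm) κ)
  map_one' := Prod.ext (map_one _) (map_one _)
  map_mul' κ κ' := Prod.ext (map_mul _ κ κ') (map_mul _ κ κ')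

/-- The narrow class group `Cl⁺(S(D))`: invertible oriented ideals modulo principal ones. -/
abbrev NarrowClassGroup (D : ℤ) : Type := OrientedIdeal D ⧸ (principalOriented D).range

def narrowClass {D : ℤ} (I : OrientedIdeal D) : NarrowClassGroup D := QuotientGroup.mk I

/-! ## Balanced triples of oriented ideals and their cubes -/

/-- The determinant of `(α₀, α₁)` with respect to the basis `(1, τ)`. -/
def coordDet {D : ℤ} (α : Fin 2 → QuadAlg D) : ℚ :=
  (α 0).re * (α 1).im - (α 0).im * (α 1).re

/-- `(α₀, α₁)` is an oriented `ℤ`-basis of the oriented ideal `(I, ε)`: it spans `I` over `ℤ`, and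
its determinant with respect to `(1, τ)` has sign `ε` (in particular it does not vanish). That
determinant is then the norm `N(I, ε) = ε |L/I| / |L/S|`, where `L` is a lattice containing `I`
and `S`. -/
def IsOrientedBasis {D : ℤ} (I : OrientedIdeal D) (α : Fin 2 → QuadAlg D) : Prop :=
  (∀ x : QuadAlg D, x ∈ I.ideal ↔
    ∃ m n : ℤ, x = m • α 0 + n • α 1) ∧
  SignType.sign (coordDet α) = I.orientation

/-- A triple of oriented ideals is balanced if `I J L ⊆ S` and `N(I) N(J) N(L) = 1`. -/
def IsBalanced {D : ℤ} (I J L : OrientedIdeal D) : Prop :=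
  I.ideal * J.ideal * L.ideal ≤ 1 ∧
  ∃ α β γ : Fin 2 → QuadAlg D, IsOrientedBasis I α ∧ IsOrientedBasis J β ∧ IsOrientedBasis L γ ∧
    coordDet α * coordDet β * coordDet γ = 1

/-- The cube `a` is attached to the balanced triple `(I, J, L)`: in suitable oriented bases
`α_A β_B γ_C = c_{ABC} + a_{ABC} τ` with integers `c_{ABC}`. -/
def CorrespondsTo {D : ℤ} (q : ChargeCube) (I J L : OrientedIdeal D) : Prop :=
  IsBalanced I J L ∧
  ∃ α β γ : Fin 2 → QuadAlg D, IsOrientedBasis I α ∧ IsOrientedBasis J β ∧ IsOrientedBasis L γ ∧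
    ∃ c : Fin 2 → Fin 2 → Fin 2 → ℤ, ∀ A B C : Fin 2,
      α A * β B * γ C = ⟨(c A B C : ℚ), (q.coeff A B C : ℚ)⟩

end

/-!
The elements of `K` are handled through eigenvectors of `√D`. A pair `α` in `K²` *has the form*
`f = a x² + b x y + c y²` (`HasForm`) if `α` is an eigenvector of `!![-b, 2 a; -2 c, b]` for the
eigenvalue `√D`. When the determinant of `α` does not vanish this says that
`N(x α₀ + y α₁) = f(x, y) det α`. Since the eigenspaces have rank one, `f` determines `α` up to a
factor in `Kˣ` (`HasForm.exists_unit`), also when `D` is a square and `K` has zero divisors. The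
`ℤ`-span of `α` is an ideal for integral `f` of discriminant `D`, and it is invertible exactly when
`f` is primitive: for primitive `f` the conjugate lattice divided by `det α` is an inverse
(`HasForm.mul_dual_eq_one`), and if `g` divides `f` then `(τ - m) / g` preserves the lattice for
some integer `m`, so it lies in `S` when the lattice is invertible
(`IsLatticeBasis.exists_hasForm`).

If `a` is the cube of three bases `α, β, γ`, then `f_S(x, y) = -det β det γ N(x α₀ + y α₁)`
(`IsCubeOf.eval_formS`), and similarly for the other slots. So the product of the three norms is an
integer as soon as the product of the three ideals lies in `S`; applied to the inverse ideals too,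
this gives the multiplicativity of the norm, and a triple is balanced exactly when its product is
trivial in the group of oriented ideals (`isBalanced_iff`). For a balanced triple the forms of the
three lattices are `-f_S, -f_T, -f_U`.

Conversely, the integers `c_{ABC}` are forced by the requirement that the slices of
`u_{ABC} = c_{ABC} + a_{ABC} τ` in the first direction be eigenvectors for `-f_S`; they are then
eigenvectors for `-f_T` in the second direction (`exists_tensor`), so that `u` is proportional
to `α_A β_B` with `α` and `β` eigenvectors for `-f_S` and `-f_T`, and this
produces `γ` (`exists_bases`).

As the forms determine the narrow classes and the first two ideals determine the third, cube classes
correspond bijectively to pairs of narrow classes (`exists_cubeClass_equiv`), and the group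
structure is transported along this bijection. Finiteness is the reduction theory of binary forms
(`OrientedIdeal.exists_reduced`). For `D < 0` norms are positive, so the orientation splits off from
the narrow class group, and it is read off from the sign of the form
(`CorrespondsTo.isDefinite_iff`); the ordinary class group enters as the Picard group of `S`
(`card_invertibleClass`).
-/

section

variable {D : ℤ}

open QuadraticAlgebra

/-! ### Binary quadratic forms -/

namespace BinForm

/-- The discriminant `b² - 4 a c`. -/
def disc (f : BinForm) : ℤ := f.b ^ 2 - 4 * f.a * f.c

/-- The opposite form `-f`. -/
def neg (f : BinForm) : BinForm := ⟨-f.a, -f.b, -f.c⟩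

theorem neg_neg (f : BinForm) : f.neg.neg = f := by
  simp [neg]

theorem eval_neg (f : BinForm) (x y : ℤ) : f.neg.eval x y = -f.eval x y := by
  simp only [eval, neg]; ring

theorem disc_neg (f : BinForm) : f.neg.disc = f.disc := by
  simp only [disc, neg]; ring

theorem IsPrimitive.neg {f : BinForm} (h : f.IsPrimitive) : f.neg.IsPrimitive := by
  simpa [IsPrimitive, BinForm.neg, Int.gcd_neg, Int.neg_gcd] using h

theorem IsPrimitive.exists_bezout {f : BinForm} (h : f.IsPrimitive) :
    ∃ u v w : ℤ, u * f.a + v * f.b + w * f.c = 1 := by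
  have h1 := Int.gcd_eq_gcd_ab (Int.gcd f.a f.b) f.c
  have h2 := Int.gcd_eq_gcd_ab f.a f.b
  unfold IsPrimitive at h
  rw [h] at h1
  refine ⟨f.a.gcdA f.b * ((f.a.gcd f.b : ℤ)).gcdA f.c, f.a.gcdB f.b * ((f.a.gcd f.b : ℤ)).gcdA f.c,
    ((f.a.gcd f.b : ℤ)).gcdB f.c, ?_⟩
  push_cast at h1
  linear_combination -h1 - ((f.a.gcd f.b : ℤ)).gcdA f.c * h2

theorem isPrimitive_of_forall {f : BinForm}
    (h : ∀ g : ℤ, g ∣ f.a → g ∣ f.b → g ∣ f.c → IsUnit g) : f.IsPrimitive := by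
  have h1 : (((f.a.gcd f.b : ℤ).gcd f.c : ℕ) : ℤ) ∣ f.a :=
    (Int.gcd_dvd_left _ _).trans (Int.gcd_dvd_left _ _)
  have h2 : (((f.a.gcd f.b : ℤ).gcd f.c : ℕ) : ℤ) ∣ f.b :=
    (Int.gcd_dvd_left _ _).trans (Int.gcd_dvd_right _ _)
  have := h _ h1 h2 (Int.gcd_dvd_right _ _)
  unfold IsPrimitive
  exact_mod_cast Int.ofNat_isUnit.mp this |> Nat.isUnit_iff.mp

/-- A form of non-zero discriminant takes a non-zero value. -/
theorem exists_eval_ne_zero {f : BinForm} (h : f.disc ≠ 0) : ∃ x y : ℤ, f.eval x y ≠ 0 := by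
  by_contra! H
  have h1 := H 1 0
  have h2 := H 0 1
  have h3 := H 1 1
  simp [eval] at h1 h2 h3
  apply h
  simp [disc, h1, h2] at h3 ⊢
  exact h3

end BinForm

/-! ### Square root of the discriminant and eigenvectors -/

/-- The square root `2 τ - (D mod 4)` of `D` in `K`. -/
def sqrtDisc (D : ℤ) : QuadAlg D := ⟨-((D % 4 : ℤ) : ℚ), 2⟩

theorem cast_disc (hD : D % 4 = 0 ∨ D % 4 = 1) :
    (D : ℚ) = 4 * ((D / 4 : ℤ) : ℚ) + ((D % 4 : ℤ) : ℚ) ^ 2 := by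
  have h : D = 4 * (D / 4) + (D % 4) ^ 2 := by
    have : (D % 4) ^ 2 = D % 4 := by rcases hD with h | h <;> rw [h] <;> norm_num
    rw [this]; omega
  exact_mod_cast h

theorem sqrtDisc_mul_self (hD : D % 4 = 0 ∨ D % 4 = 1) :
    sqrtDisc D * sqrtDisc D = (D : QuadAlg D) := by
  have h := cast_disc hD
  ext
  · simp [sqrtDisc]; linear_combination -h
  · simp [sqrtDisc]; ring

theorem isUnit_of_norm_ne_zero {z : QuadAlg D} (h : z.norm ≠ 0) : IsUnit z :=
  isUnit_iff_norm_isUnit.mpr (isUnit_iff_ne_zero.mpr h)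

theorem norm_ne_zero_of_unit (κ : (QuadAlg D)ˣ) : (κ : QuadAlg D).norm ≠ 0 :=
  (isUnit_iff_norm_isUnit.mp κ.isUnit).ne_zero

theorem intCast_mul_cancel {m : ℤ} (hm : m ≠ 0) {z w : QuadAlg D}
    (h : (m : QuadAlg D) * z = m * w) : z = w := by
  have hm' : (m : ℚ) ≠ 0 := by exact_mod_cast hm
  have h1 := congrArg QuadraticAlgebra.re h
  have h2 := congrArg QuadraticAlgebra.im h
  simp [hm] at h1 h2
  exact QuadraticAlgebra.ext h1 h2

theorem sqrtDisc_mul_cancel (hD0 : D ≠ 0) (hD : D % 4 = 0 ∨ D % 4 = 1) {z w : QuadAlg D}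
    (h : sqrtDisc D * z = sqrtDisc D * w) : z = w := by
  refine intCast_mul_cancel hD0 ?_
  rw [← sqrtDisc_mul_self hD, mul_assoc, mul_assoc, h]

/-- The pair `α` is an eigenvector, with eigenvalue `√D`, of the matrix
`!![-b, 2 a; -2 c, b]` attached to the form `a x² + b x y + c y²`. -/
structure HasForm (f : BinForm) (α : Fin 2 → QuadAlg D) : Prop where
  left : sqrtDisc D * α 0 = -(f.b : QuadAlg D) * α 0 + 2 * f.a * α 1
  right : sqrtDisc D * α 1 = -2 * (f.c : QuadAlg D) * α 0 + f.b * α 1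

theorem HasForm.iff_coord (f : BinForm) (α : Fin 2 → QuadAlg D) : HasForm f α ↔
    ((-((D % 4 : ℤ) : ℚ)) * (α 0).re + 2 * ((D / 4 : ℤ) : ℚ) * (α 0).im
      = -(f.b : ℚ) * (α 0).re + 2 * f.a * (α 1).re ∧
    2 * (α 0).re + ((D % 4 : ℤ) : ℚ) * (α 0).im = -(f.b : ℚ) * (α 0).im + 2 * f.a * (α 1).im) ∧
    ((-((D % 4 : ℤ) : ℚ)) * (α 1).re + 2 * ((D / 4 : ℤ) : ℚ) * (α 1).im
      = -2 * (f.c : ℚ) * (α 0).re + f.b * (α 1).re ∧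
    2 * (α 1).re + ((D % 4 : ℤ) : ℚ) * (α 1).im = -2 * (f.c : ℚ) * (α 0).im + f.b * (α 1).im) := by
  have key : ∀ z w : QuadAlg D, z = w ↔ z.re = w.re ∧ z.im = w.im := fun z w =>
    ⟨fun h => h ▸ ⟨rfl, rfl⟩, fun h => QuadraticAlgebra.ext h.1 h.2⟩
  have h2 : (2 : QuadAlg D).re = 2 := rfl
  have h3 : (2 : QuadAlg D).im = 0 := rfl
  constructor
  · rintro ⟨h, h'⟩
    rw [key] at h h'
    obtain ⟨h1, h4⟩ := h
    obtain ⟨h5, h6⟩ := h'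
    simp [sqrtDisc] at h1 h4 h5 h6
    refine ⟨⟨?_, ?_⟩, ⟨?_, ?_⟩⟩ <;> linarith
  · rintro ⟨⟨h1, h4⟩, ⟨h5, h6⟩⟩
    constructor <;> rw [key] <;> constructor <;> simp [sqrtDisc] <;> linarith

theorem norm_comb (α : Fin 2 → QuadAlg D) (x y : ℤ) :
    (x • α 0 + y • α 1).norm = (x * (α 0).re + y * (α 1).re) ^ 2
      + ((D % 4 : ℤ) : ℚ) * (x * (α 0).re + y * (α 1).re) * (x * (α 0).im + y * (α 1).im)
      - ((D / 4 : ℤ) : ℚ) * (x * (α 0).im + y * (α 1).im) ^ 2 := by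
  rw [norm_def]
  simp
  ring

/-- For an eigenvector, the norm form on the lattice it spans is the given form,
scaled by the determinant. -/
theorem HasForm.norm_eq {f : BinForm} {α : Fin 2 → QuadAlg D} (h : HasForm f α) (x y : ℤ) :
    (x • α 0 + y • α 1).norm = f.eval x y * coordDet α := by
  obtain ⟨⟨h1, h2⟩, ⟨h3, h4⟩⟩ := (HasForm.iff_coord f α).mp h
  rw [norm_comb]
  simp only [BinForm.eval, coordDet]
  push_cast at *
  linear_combination (x ^ 2 * (α 0).re / 2 + x * y * (α 1).re / 2) * h2
    - (x ^ 2 * (α 0).im / 2 + x * y * (α 1).im / 2 ) * h1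
    + (x * y * (α 0).re / 2 + y ^ 2 * (α 1).re / 2) * h4
    - (x * y * (α 0).im / 2 + y ^ 2 * (α 1).im / 2) * h3

/-- Converse of `HasForm.norm_eq`; it fails for degenerate pairs. -/
theorem hasForm_of_norm_eq {f : BinForm} {α : Fin 2 → QuadAlg D} (hα : coordDet α ≠ 0)
    (h : ∀ x y : ℤ, (x • α 0 + y • α 1).norm = f.eval x y * coordDet α) : HasForm f α := by
  have ha := h 1 0
  have hc := h 0 1
  have hb := h 1 1
  rw [norm_comb] at ha hb hc
  simp only [BinForm.eval] at ha hb hc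
  push_cast at ha hb hc
  set d := coordDet α with hd
  unfold coordDet at hd
  rw [HasForm.iff_coord]
  refine ⟨⟨?_, ?_⟩, ⟨?_, ?_⟩⟩ <;> apply mul_right_cancel₀ hα
  · linear_combination -(α 0).re * (hb - ha - hc) + 2 * (α 1).re * ha
      + (-((D % 4 : ℤ) : ℚ) * (α 0).re + 2 * ((D / 4 : ℤ) : ℚ) * (α 0).im) * hd
  · linear_combination -(α 0).im * (hb - ha - hc) + 2 * (α 1).im * ha
      + (2 * (α 0).re + ((D % 4 : ℤ) : ℚ) * (α 0).im) * hd
  · linear_combination (α 1).re * (hb - ha - hc) - 2 * (α 0).re * hc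
      + (-((D % 4 : ℤ) : ℚ) * (α 1).re + 2 * ((D / 4 : ℤ) : ℚ) * (α 1).im) * hd
  · linear_combination (α 1).im * (hb - ha - hc) - 2 * (α 0).im * hc
      + (2 * (α 1).re + ((D % 4 : ℤ) : ℚ) * (α 1).im) * hd

/-- The matrix of an eigenvector squares to `disc f`, and `√D` squares to `D`. -/
theorem HasForm.disc_eq (hD : D % 4 = 0 ∨ D % 4 = 1) {f : BinForm} {α : Fin 2 → QuadAlg D}
    (h : HasForm f α) (hα : coordDet α ≠ 0) : f.disc = D := by
  have e := sqrtDisc_mul_self hD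
  have h0 : (f.disc : QuadAlg D) * α 0 = D * α 0 := by
    simp only [BinForm.disc]
    push_cast
    linear_combination (f.b - sqrtDisc D) * h.left - 2 * f.a * h.right + α 0 * e
  have h2 := congrArg QuadraticAlgebra.re h0
  have h3 := congrArg QuadraticAlgebra.im h0
  simp only [re_mul, im_mul, re_intCast, im_intCast] at h2 h3
  have : (f.disc : ℚ) = D := by
    apply mul_right_cancel₀ hα
    simp only [coordDet]
    linear_combination (α 1).im * h2 - (α 1).re * h3
  exact_mod_cast this

/-- The eigenspaces of `√D` have rank one: the determinant of two eigenvectors is killed by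
`2 √D`, which is not a zero divisor. -/
theorem HasForm.cross_eq (hD0 : D ≠ 0) (hD : D % 4 = 0 ∨ D % 4 = 1) {f : BinForm}
    {α u : Fin 2 → QuadAlg D} (h : HasForm f α) (h' : HasForm f u) : α 0 * u 1 = α 1 * u 0 := by
  apply sqrtDisc_mul_cancel hD0 hD
  have h2 : (2 : QuadAlg D) * (sqrtDisc D * (α 0 * u 1)) = 2 * (sqrtDisc D * (α 1 * u 0)) := by
    linear_combination u 1 * h.left - u 0 * h.right - α 1 * h'.left + α 0 * h'.right
  exact intCast_mul_cancel (m := 2) two_ne_zero (by exact_mod_cast h2)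

theorem HasForm.cross_eq' (hD0 : D ≠ 0) (hD : D % 4 = 0 ∨ D % 4 = 1) {f : BinForm}
    {α u : Fin 2 → QuadAlg D} (h : HasForm f α) (h' : HasForm f u) (i j : Fin 2) :
    α i * u j = α j * u i := by
  have := h.cross_eq hD0 hD h'
  fin_cases i <;> fin_cases j <;> simp [this]

/-- A lattice with non-zero determinant contains an invertible element. When `D` is a square the
basis vectors themselves may be zero divisors. -/
theorem HasForm.exists_isUnit (hD0 : D ≠ 0) (hD : D % 4 = 0 ∨ D % 4 = 1) {f : BinForm}
    {α : Fin 2 → QuadAlg D} (h : HasForm f α) (hα : coordDet α ≠ 0) :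
    ∃ x y : ℤ, f.eval x y ≠ 0 ∧ IsUnit (x • α 0 + y • α 1) := by
  obtain ⟨x, y, hxy⟩ := BinForm.exists_eval_ne_zero (by rwa [h.disc_eq hD hα] : f.disc ≠ 0)
  refine ⟨x, y, hxy, isUnit_of_norm_ne_zero ?_⟩
  rw [h.norm_eq]
  exact mul_ne_zero (by exact_mod_cast hxy) hα

/-- Two bases with the same form are proportional. -/
theorem HasForm.exists_unit (hD0 : D ≠ 0) (hD : D % 4 = 0 ∨ D % 4 = 1) {f : BinForm}
    {α u : Fin 2 → QuadAlg D} (h : HasForm f α) (h' : HasForm f u) (hα : coordDet α ≠ 0)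
    (hu : coordDet u ≠ 0) : ∃ κ : (QuadAlg D)ˣ, ∀ i, u i = κ * α i := by
  obtain ⟨x, y, hxy, v, hv⟩ := h.exists_isUnit hD0 hD hα
  have hw : IsUnit (x • u 0 + y • u 1) := by
    apply isUnit_of_norm_ne_zero
    rw [h'.norm_eq]
    exact mul_ne_zero (by exact_mod_cast hxy) hu
  obtain ⟨w, hw⟩ := hw
  refine ⟨w * v⁻¹, fun i => ?_⟩
  have h0 := h.cross_eq' hD0 hD h' i 0
  have h1 := h.cross_eq' hD0 hD h' i 1
  apply v.isUnit.mul_left_cancel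
  have e : (v : QuadAlg D) * ((w * v⁻¹ : (QuadAlg D)ˣ) * α i) = w * α i := by
    rw [← mul_assoc, ← Units.val_mul]; congr 2; rw [mul_comm w, mul_inv_cancel_left]
  rw [e, hw, hv]
  simp only [zsmul_eq_mul]
  linear_combination -(x : QuadAlg D) * h0 - y * h1

/-- Every form of discriminant `D` is the form of some basis of `K`. -/
theorem exists_hasForm (hD0 : D ≠ 0) (hD : D % 4 = 0 ∨ D % 4 = 1) {f : BinForm}
    (hf : f.disc = D) : ∃ α : Fin 2 → QuadAlg D, HasForm f α ∧ coordDet α ≠ 0 := by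
  obtain ⟨x, y, hxy⟩ := BinForm.exists_eval_ne_zero (by rwa [hf] : f.disc ≠ 0)
  -- The columns of `√D + M` are eigenvectors; their combination with coefficients `x` and `-y` has
  -- determinant `4 f(x, y)`.
  refine ⟨![2 * f.a * x - (f.b - sqrtDisc D) * (-y), (f.b + sqrtDisc D) * x - 2 * f.c * (-y)],
    ?_, ?_⟩
  · have e := sqrtDisc_mul_self hD
    have hf' : (D : QuadAlg D) = f.b ^ 2 - 4 * f.a * f.c := by
      have := congrArg (Int.cast : ℤ → QuadAlg D) hf
      rw [← this, BinForm.disc]; push_cast; ring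
    rw [hf'] at e
    constructor
    · simp
      linear_combination -(y : QuadAlg D) * e
    · simp
      linear_combination (x : QuadAlg D) * e
  · have : (4 : ℚ) * f.eval x y ≠ 0 := by
      exact mul_ne_zero (by norm_num) (by exact_mod_cast hxy)
    convert this using 1
    simp [coordDet, sqrtDisc, BinForm.eval]
    ring

/-! ### Lattices and invertible ideals -/

theorem algebraMap_quadRing (s : QuadRing D) :
    algebraMap (QuadRing D) (QuadAlg D) s = ⟨(s.re : ℚ), (s.im : ℚ)⟩ := rfl

theorem mem_one_iff (x : QuadAlg D) :
    x ∈ (1 : Submodule (QuadRing D) (QuadAlg D)) ↔ ∃ m n : ℤ, x = ⟨(m : ℚ), (n : ℚ)⟩ := by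
  rw [Submodule.mem_one]
  constructor
  · rintro ⟨s, rfl⟩; exact ⟨s.re, s.im, rfl⟩
  · rintro ⟨m, n, rfl⟩; exact ⟨⟨m, n⟩, rfl⟩

/-- `(α₀, α₁)` spans the submodule `M` of `K` over `ℤ`. -/
def IsLatticeBasis (M : Submodule (QuadRing D) (QuadAlg D)) (α : Fin 2 → QuadAlg D) : Prop :=
  ∀ x : QuadAlg D, x ∈ M ↔ ∃ m n : ℤ, x = m • α 0 + n • α 1

theorem IsLatticeBasis.mem {M : Submodule (QuadRing D) (QuadAlg D)} {α : Fin 2 → QuadAlg D}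
    (h : IsLatticeBasis M α) (i : Fin 2) : α i ∈ M := by
  rw [h]
  fin_cases i
  · exact ⟨1, 0, by simp⟩
  · exact ⟨0, 1, by simp⟩

theorem IsLatticeBasis.eq {M N : Submodule (QuadRing D) (QuadAlg D)} {α : Fin 2 → QuadAlg D}
    (h : IsLatticeBasis M α) (h' : IsLatticeBasis N α) : M = N := by
  ext x; rw [h, h']

/-- A lattice is closed under multiplication by `τ`; this is the integral matrix of that map. -/
theorem HasForm.tau_mul {f : BinForm} {α : Fin 2 → QuadAlg D}
    (h : HasForm f α) (hf : f.disc = D) : ∃ k : ℤ, D % 4 = 2 * k + f.b ∧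
      (⟨0, 1⟩ : QuadAlg D) * α 0 = k * α 0 + f.a * α 1 ∧
      (⟨0, 1⟩ : QuadAlg D) * α 1 = -f.c * α 0 + (k + f.b) * α 1 := by
  obtain ⟨k, hk⟩ : ∃ k : ℤ, D % 4 = 2 * k + f.b := by
    have h1 : f.b ^ 2 = D + 4 * (f.a * f.c) := by rw [← hf, BinForm.disc]; ring
    have h2 : f.b ^ 2 % 4 = D % 4 := by omega
    rcases Int.emod_two_eq_zero_or_one f.b with hb | hb
    · have : f.b ^ 2 % 4 = 0 := by
        obtain ⟨m, hm⟩ : ∃ m, f.b = 2 * m := ⟨f.b / 2, by omega⟩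
        rw [hm]; ring_nf; omega
      exact ⟨(D % 4 - f.b) / 2, by omega⟩
    · have : f.b ^ 2 % 4 = 1 := by
        obtain ⟨m, hm⟩ : ∃ m, f.b = 2 * m + 1 := ⟨f.b / 2, by omega⟩
        rw [hm]; ring_nf; omega
      exact ⟨(D % 4 - f.b) / 2, by omega⟩
  have e : (2 : QuadAlg D) * ⟨0, 1⟩ = sqrtDisc D + (2 * k + f.b) := by
    have hk' : ((D % 4 : ℤ) : ℚ) = 2 * k + f.b := by exact_mod_cast hk
    ext <;> simp [sqrtDisc, hk']
  refine ⟨k, hk, ?_, ?_⟩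
  · apply intCast_mul_cancel (m := 2) two_ne_zero
    push_cast
    linear_combination α 0 * e + h.left
  · apply intCast_mul_cancel (m := 2) two_ne_zero
    push_cast
    linear_combination α 1 * e + h.right

/-- The lattice spanned by a pair with a form is a fractional ideal. -/
theorem HasForm.exists_submodule {f : BinForm}
    {α : Fin 2 → QuadAlg D} (h : HasForm f α) (hf : f.disc = D) :
    ∃ M : Submodule (QuadRing D) (QuadAlg D), IsLatticeBasis M α := by
  obtain ⟨k, -, h0, h1⟩ := h.tau_mul hf
  refine ⟨{ carrier := {x | ∃ m n : ℤ, x = m • α 0 + n • α 1}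
            add_mem' := ?_, zero_mem' := ⟨0, 0, by simp⟩, smul_mem' := ?_ }, fun x => Iff.rfl⟩
  · rintro _ _ ⟨m, n, rfl⟩ ⟨m', n', rfl⟩
    exact ⟨m + m', n + n', by simp only [zsmul_eq_mul]; push_cast; ring⟩
  · rintro s _ ⟨m, n, rfl⟩
    refine ⟨s.re * m + s.im * (m * k - n * f.c), s.re * n + s.im * (m * f.a + n * (k + f.b)), ?_⟩
    have e : (⟨(s.re : ℚ), (s.im : ℚ)⟩ : QuadAlg D) = s.re + s.im * ⟨0, 1⟩ := by
      ext <;> simp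
    rw [Algebra.smul_def, algebraMap_quadRing, e]
    simp only [zsmul_eq_mul]
    push_cast
    linear_combination (s.im : QuadAlg D) * m * h0 + (s.im : QuadAlg D) * n * h1

/-- The basis of the inverse lattice: the conjugate of `α`, divided by the determinant. -/
def dualBasis (α : Fin 2 → QuadAlg D) : Fin 2 → QuadAlg D :=
  ![((coordDet α)⁻¹ : ℚ) • star (α 1), ((coordDet α)⁻¹ : ℚ) • star (α 0)]

theorem dualBasis_zero (α : Fin 2 → QuadAlg D) :
    dualBasis α 0 = ⟨(coordDet α)⁻¹ * ((α 1).re + ((D % 4 : ℤ) : ℚ) * (α 1).im),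
      -(coordDet α)⁻¹ * (α 1).im⟩ := by
  ext <;> simp [dualBasis]

theorem dualBasis_one (α : Fin 2 → QuadAlg D) :
    dualBasis α 1 = ⟨(coordDet α)⁻¹ * ((α 0).re + ((D % 4 : ℤ) : ℚ) * (α 0).im),
      -(coordDet α)⁻¹ * (α 0).im⟩ := by
  ext <;> simp [dualBasis]

theorem coordDet_dualBasis (α : Fin 2 → QuadAlg D) : coordDet (dualBasis α) = (coordDet α)⁻¹ := by
  rw [coordDet, dualBasis_zero, dualBasis_one]
  by_cases h : coordDet α = 0
  · simp [h]
  · field_simp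
    simp only [coordDet]
    ring

theorem HasForm.hasForm_dualBasis {f : BinForm} {α : Fin 2 → QuadAlg D} (h : HasForm f α)
    (hα : coordDet α ≠ 0) : HasForm ⟨f.c, f.b, f.a⟩ (dualBasis α) := by
  apply hasForm_of_norm_eq
  · rw [coordDet_dualBasis]; exact inv_ne_zero hα
  intro x y
  have := h.norm_eq y x
  rw [coordDet_dualBasis, norm_comb, dualBasis_zero, dualBasis_one]
  rw [norm_comb] at this
  simp only [BinForm.eval] at this ⊢
  push_cast at this ⊢
  field_simp
  linear_combination this

/-- The products of a basis with its dual basis: they lie in `S`, and the coefficients of the form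
are integral combinations of them. -/
theorem dualBasis_mul {f : BinForm} {α : Fin 2 → QuadAlg D} (h : HasForm f α)
    (hα : coordDet α ≠ 0) {k : ℤ} (hk : D % 4 = 2 * k + f.b) :
    α 0 * dualBasis α 1 = f.a ∧ α 1 * dualBasis α 0 = f.c ∧
    α 0 * dualBasis α 0 = ⟨((k + f.b : ℤ) : ℚ), ((-1 : ℤ) : ℚ)⟩ ∧
    α 1 * dualBasis α 1 = ⟨((-k : ℤ) : ℚ), ((1 : ℤ) : ℚ)⟩ := by
  have ha := h.norm_eq 1 0
  have hc := h.norm_eq 0 1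
  have hb := h.norm_eq 1 1
  rw [norm_comb] at ha hb hc
  simp only [BinForm.eval] at ha hb hc
  have hk' : ((D % 4 : ℤ) : ℚ) = 2 * k + f.b := by exact_mod_cast hk
  rw [dualBasis_zero, dualBasis_one]
  set d := coordDet α with hd
  unfold coordDet at hd
  push_cast at ha hb hc
  refine ⟨?_, ?_, ?_, ?_⟩ <;> ext <;> simp <;> field_simp
  · linear_combination ha
  · ring
  · linear_combination hc
  · ring
  · linear_combination (hb - ha - hc) / 2 - ((D % 4 : ℤ) : ℚ) / 2 * hd + d / 2 * hk'
  · linear_combination hd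
  · linear_combination (hb - ha - hc) / 2 + ((D % 4 : ℤ) : ℚ) / 2 * hd - d / 2 * hk'
  · linear_combination -hd

theorem mul_le_one_of_bases {M N : Submodule (QuadRing D) (QuadAlg D)} {α β : Fin 2 → QuadAlg D}
    (hM : IsLatticeBasis M α) (hN : IsLatticeBasis N β)
    (h : ∀ i j, α i * β j ∈ (1 : Submodule (QuadRing D) (QuadAlg D))) : M * N ≤ 1 := by
  rw [Submodule.mul_le]
  intro x hx y hy
  obtain ⟨m, n, rfl⟩ := (hM x).mp hx
  obtain ⟨m', n', rfl⟩ := (hN y).mp hy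
  have : (m • α 0 + n • α 1) * (m' • β 0 + n' • β 1) = (m * m') • (α 0 * β 0)
      + (m * n') • (α 0 * β 1) + (n * m') • (α 1 * β 0) + (n * n') • (α 1 * β 1) := by
    simp only [zsmul_eq_mul]; push_cast; ring
  rw [this]
  exact add_mem (add_mem (add_mem (zsmul_mem (h _ _) _) (zsmul_mem (h _ _) _))
    (zsmul_mem (h _ _) _)) (zsmul_mem (h _ _) _)

/-- A lattice with a primitive form is invertible, the inverse being spanned by the dual
basis. -/
theorem HasForm.mul_dual_eq_one (hD : D % 4 = 0 ∨ D % 4 = 1) {f : BinForm}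
    {α : Fin 2 → QuadAlg D} (h : HasForm f α) (hα : coordDet α ≠ 0) (hf : f.IsPrimitive)
    {M N : Submodule (QuadRing D) (QuadAlg D)}
    (hM : IsLatticeBasis M α) (hN : IsLatticeBasis N (dualBasis α)) : M * N = 1 := by
  obtain ⟨k, hk, -⟩ := h.tau_mul (h.disc_eq hD hα)
  obtain ⟨h1, h2, h3, h4⟩ := dualBasis_mul h hα hk
  apply le_antisymm
  · apply mul_le_one_of_bases hM hN
    have hint : ∀ m : ℤ, (m : QuadAlg D) ∈ (1 : Submodule (QuadRing D) (QuadAlg D)) := fun m =>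
      (mem_one_iff _).mpr ⟨m, 0, by ext <;> simp⟩
    intro i j
    fin_cases i <;> fin_cases j
    · exact (mem_one_iff _).mpr ⟨_, _, h3⟩
    · change α 0 * dualBasis α 1 ∈ _
      rw [h1]; exact hint _
    · change α 1 * dualBasis α 0 ∈ _
      rw [h2]; exact hint _
    · exact (mem_one_iff _).mpr ⟨_, _, h4⟩
  · rw [Submodule.one_le]
    obtain ⟨u, v, w, huvw⟩ := hf.exists_bezout
    have h5 : α 0 * dualBasis α 0 + α 1 * dualBasis α 1 = f.b := by
      rw [h3, h4]; ext <;> simp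
    have : (1 : QuadAlg D) = u • (α 0 * dualBasis α 1)
        + v • (α 0 * dualBasis α 0 + α 1 * dualBasis α 1) + w • (α 1 * dualBasis α 0) := by
      rw [h1, h2, h5]; simp only [zsmul_eq_mul]; exact_mod_cast huvw.symm
    rw [this]
    have hm : ∀ i j, α i * dualBasis α j ∈ M * N := fun i j =>
      Submodule.mul_mem_mul (hM.mem i) (hN.mem j)
    exact add_mem (add_mem (zsmul_mem (hm _ _) _) (zsmul_mem (add_mem (hm _ _) (hm _ _)) _))
      (zsmul_mem (hm _ _) _)

/-- The sign of a non-zero rational number, as a unit. -/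
noncomputable def unitSign (r : ℚ) (h : r ≠ 0) : SignTypeˣ :=
  Units.mk0 (SignType.sign r) (by simpa [sign_eq_zero_iff] using h)

theorem HasForm.exists_orientedIdeal (hD : D % 4 = 0 ∨ D % 4 = 1) {f : BinForm}
    {α : Fin 2 → QuadAlg D} (h : HasForm f α) (hα : coordDet α ≠ 0) (hf : f.IsPrimitive) :
    ∃ I : OrientedIdeal D, IsOrientedBasis I α ∧ IsOrientedBasis I⁻¹ (dualBasis α) := by
  have hα' : coordDet (dualBasis α) ≠ 0 := by rw [coordDet_dualBasis]; exact inv_ne_zero hα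
  obtain ⟨M, hM⟩ := h.exists_submodule (h.disc_eq hD hα)
  have h' := h.hasForm_dualBasis hα
  obtain ⟨N, hN⟩ := h'.exists_submodule (h'.disc_eq hD hα')
  have hMN := h.mul_dual_eq_one hD hα hf hM hN
  refine ⟨(⟨M, N, hMN, by rw [mul_comm, hMN]⟩, unitSign _ hα), ⟨hM, rfl⟩, ⟨hN, ?_⟩⟩
  rw [coordDet_dualBasis]
  change _ = (((unitSign _ hα)⁻¹ : SignTypeˣ) : SignType)
  rw [Units.val_inv_eq_inv_val]
  change _ = (SignType.sign (coordDet α))⁻¹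
  rcases lt_or_gt_of_ne hα with h | h
  · rw [sign_neg h, sign_neg (inv_lt_zero.mpr h)]; rfl
  · rw [sign_pos h, sign_pos (inv_pos.mpr h)]; rfl

/-- An invertible lattice has a primitive form. -/
theorem IsLatticeBasis.exists_hasForm {U : (Submodule (QuadRing D) (QuadAlg D))ˣ}
    {α : Fin 2 → QuadAlg D} (hα : IsLatticeBasis U.1 α) (hdet : coordDet α ≠ 0) :
    ∃ f : BinForm, f.IsPrimitive ∧ HasForm f α := by
  have htau : ∀ i, (⟨0, 1⟩ : QuadAlg D) * α i ∈ U.1 := fun i => by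
    have := U.1.smul_mem (⟨0, 1⟩ : QuadRing D) (hα.mem i)
    rw [Algebra.smul_def, algebraMap_quadRing] at this
    simpa using this
  obtain ⟨m, n, h0⟩ := (hα _).mp (htau 0)
  obtain ⟨m', n', h1⟩ := (hα _).mp (htau 1)
  have h0r := congrArg QuadraticAlgebra.re h0
  have h0i := congrArg QuadraticAlgebra.im h0
  have h1r := congrArg QuadraticAlgebra.re h1
  have h1i := congrArg QuadraticAlgebra.im h1
  simp at h0r h0i h1r h1i
  refine ⟨⟨n, n' - m, -m'⟩, BinForm.isPrimitive_of_forall ?_, hasForm_of_norm_eq hdet ?_⟩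
  · -- If `g` divides the form, `z = (τ - m) / g` maps the lattice into itself, hence lies in `S`.
    rintro g ⟨u, hu⟩ ⟨v, hv⟩ ⟨w, hw⟩
    simp only at hu hv hw
    have hg : g ≠ 0 := by
      rintro rfl
      have hn : n = 0 := by linarith
      have hn' : n' = m := by linarith
      have hm' : m' = 0 := by linarith
      subst hn hn' hm'
      apply hdet
      simp only [coordDet]
      push_cast at h0i h1i
      linear_combination (α 1).im * h0i - (α 0).im * h1i
    have hgq : (g : ℚ) ≠ 0 := by exact_mod_cast hg
    let z : QuadAlg D := ⟨-m / g, 1 / g⟩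
    have hz : (g : QuadAlg D) * z = ⟨0, 1⟩ - m := by
      ext <;> simp [z] <;> field_simp
    have hz0 : z * α 0 = (0 : ℤ) • α 0 + u • α 1 := by
      apply intCast_mul_cancel hg
      rw [← mul_assoc, hz, sub_mul, h0, hu]
      simp only [zsmul_eq_mul]; push_cast; ring
    have hz1 : z * α 1 = (-w) • α 0 + v • α 1 := by
      have hn' : n' = m + g * v := by linarith
      have hm' : m' = -(g * w) := by linarith
      apply intCast_mul_cancel hg
      rw [← mul_assoc, hz, sub_mul, h1, hn', hm']
      simp only [zsmul_eq_mul]; push_cast; ring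
    have hzU : ∀ x ∈ U.1, z * x ∈ U.1 := by
      intro x hx
      obtain ⟨p, q, rfl⟩ := (hα x).mp hx
      have e : z * (p • α 0 + q • α 1) = p • (z * α 0) + q • (z * α 1) := by
        simp only [zsmul_eq_mul]; ring
      rw [e]
      exact add_mem (zsmul_mem ((hα _).mpr ⟨_, _, hz0⟩) _) (zsmul_mem ((hα _).mpr ⟨_, _, hz1⟩) _)
    have hz1 : z ∈ (1 : Submodule (QuadRing D) (QuadAlg D)) := by
      have h1 : (1 : QuadAlg D) ∈ U.1 * U.2 := by
        rw [U.val_inv]; exact Submodule.one_le.mp le_rfl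
      have key : ∀ y ∈ U.1 * U.2, z * y ∈ U.1 * U.2 := by
        intro y hy
        induction hy using Submodule.mul_induction_on' with
        | mem_mul_mem a ha b hb =>
          rw [← mul_assoc]; exact Submodule.mul_mem_mul (hzU a ha) hb
        | add a _ b _ iha ihb => rw [mul_add]; exact add_mem iha ihb
      have := key 1 h1
      rwa [mul_one, U.val_inv] at this
    obtain ⟨p, q, hpq⟩ := (mem_one_iff _).mp hz1
    have := congrArg QuadraticAlgebra.im hpq
    simp only [z] at this
    rw [div_eq_iff hgq] at this
    exact IsUnit.of_mul_eq_one_right q (by exact_mod_cast this.symm)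
  · intro x y
    rw [norm_comb]
    simp only [BinForm.eval, coordDet]
    push_cast at *
    linear_combination (x * (α 0).re + y * (α 1).re) * (x * h0i + y * h1i)
      - (x * (α 0).im + y * (α 1).im) * (x * h0r + y * h1r)

theorem tau_mul_mem {M : Submodule (QuadRing D) (QuadAlg D)} {x : QuadAlg D} (hx : x ∈ M) :
    (⟨0, 1⟩ : QuadAlg D) * x ∈ M := by
  have := M.smul_mem (⟨0, 1⟩ : QuadRing D) hx
  rw [Algebra.smul_def, algebraMap_quadRing] at this
  simpa using this

/-- An invertible ideal spans `K` over `ℚ`. -/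
theorem span_rat_eq_top (U : (Submodule (QuadRing D) (QuadAlg D))ˣ) :
    Submodule.span ℚ (U.1 : Set (QuadAlg D)) = ⊤ := by
  rw [eq_top_iff]
  rintro x -
  have key : ∀ y ∈ U.1 * U.2, y * x ∈ Submodule.span ℚ (U.1 : Set (QuadAlg D)) := by
    intro y hy
    induction hy using Submodule.mul_induction_on' with
    | mem_mul_mem a ha b hb =>
      have e : a * b * x = (b * x).re • a + (b * x).im • ((⟨0, 1⟩ : QuadAlg D) * a) := by
        ext <;> simp <;> ring
      rw [e]
      exact add_mem (Submodule.smul_mem _ _ (Submodule.subset_span ha))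
        (Submodule.smul_mem _ _ (Submodule.subset_span (tau_mul_mem ha)))
    | add a _ b _ iha ihb => rw [add_mul]; exact add_mem iha ihb
  have := key 1 (by rw [U.val_inv]; exact Submodule.one_le.mp le_rfl)
  rwa [one_mul] at this

/-- Every invertible ideal is a lattice of rank two. -/
theorem exists_latticeBasis (U : (Submodule (QuadRing D) (QuadAlg D))ˣ) :
    ∃ α : Fin 2 → QuadAlg D, IsLatticeBasis U.1 α ∧ coordDet α ≠ 0 := by
  let N : Submodule ℤ (QuadAlg D) := U.1.restrictScalars ℤ
  have hfg : N.FG := by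
    have := Submodule.fg_unit U
    exact this.restrictScalars
  have : Module.Finite ℤ N := Module.Finite.iff_fg.mpr hfg
  let b := Module.finBasis ℤ N
  have hmem : ∀ x : QuadAlg D, x ∈ U.1 ↔ ∃ c : Fin (Module.finrank ℤ N) → ℤ,
      x = ∑ i, c i • (b i : QuadAlg D) := fun x => b.mem_submodule_iff'
  have hli : LinearIndependent ℚ (fun i => (b i : QuadAlg D)) := by
    have : LinearIndependent ℤ (fun i => (b i : QuadAlg D)) :=
      b.linearIndependent.map' N.subtype (Submodule.ker_subtype N)
    exact (LinearIndependent.iff_fractionRing ℤ ℚ).mp this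
  have hspan : ⊤ ≤ Submodule.span ℚ (Set.range fun i => (b i : QuadAlg D)) := by
    rw [← span_rat_eq_top U, Submodule.span_le]
    intro x hx
    obtain ⟨c, rfl⟩ := (hmem x).mp hx
    exact sum_mem fun i _ => zsmul_mem (Submodule.subset_span (Set.mem_range_self i)) _
  -- A `ℤ`-basis of the ideal is a `ℚ`-basis of `K`, so it has two elements.
  have hn : Module.finrank ℤ N = 2 := by
    have := Module.finrank_eq_card_basis (Module.Basis.mk hli hspan)
    rw [QuadraticAlgebra.finrank_eq_two] at this
    simpa using this.symm
  let e := finCongr hn.symm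
  refine ⟨fun i => b (e i), fun x => ?_, fun h => ?_⟩
  · rw [hmem]
    constructor
    · rintro ⟨c, rfl⟩
      refine ⟨c (e 0), c (e 1), ?_⟩
      rw [← e.sum_comp, Fin.sum_univ_two]
    · rintro ⟨m, n, rfl⟩
      refine ⟨fun i => ![m, n] (e.symm i), ?_⟩
      rw [← e.sum_comp, Fin.sum_univ_two]
      simp
  · have hli' := LinearIndependent.comp hli e e.injective
    have hp : (fun i => (b (e i) : QuadAlg D)) =
        ![(b (e 0) : QuadAlg D), (b (e 1) : QuadAlg D)] := by
      ext i <;> fin_cases i <;> rfl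
    change LinearIndependent ℚ (fun i => (b (e i) : QuadAlg D)) at hli'
    rw [hp, LinearIndependent.pair_iff] at hli'
    simp only [coordDet] at h
    have h1 := hli' (b (e 1) : QuadAlg D).im (-(b (e 0) : QuadAlg D).im)
      (by ext <;> simp <;> linarith)
    have h2 := hli' (b (e 1) : QuadAlg D).re (-(b (e 0) : QuadAlg D).re)
      (by ext <;> simp <;> linarith)
    have h3 : (b (e 1) : QuadAlg D) = 0 := QuadraticAlgebra.ext h2.1 h1.1
    have h4 := hli' 0 1 (by simp [h3])
    exact one_ne_zero h4.2

/-! ### Oriented bases -/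

/-- The pair `g α`, for an integral matrix `g`. -/
def changeBasis (g : Matrix (Fin 2) (Fin 2) ℤ) (α : Fin 2 → QuadAlg D) : Fin 2 → QuadAlg D :=
  fun i => g i 0 • α 0 + g i 1 • α 1

theorem changeBasis_changeBasis (g h : Matrix (Fin 2) (Fin 2) ℤ) (α : Fin 2 → QuadAlg D) :
    changeBasis g (changeBasis h α) = changeBasis (g * h) α := by
  funext i
  simp only [changeBasis, Matrix.mul_apply, Fin.sum_univ_two, zsmul_eq_mul]
  push_cast
  ring

theorem changeBasis_one (α : Fin 2 → QuadAlg D) : changeBasis 1 α = α := by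
  have : ∀ i, changeBasis 1 α i = α i := by
    rw [Fin.forall_fin_two]
    simp [changeBasis]
  exact funext this

theorem coordDet_changeBasis (g : Matrix (Fin 2) (Fin 2) ℤ) (α : Fin 2 → QuadAlg D) :
    coordDet (changeBasis g α) = g.det * coordDet α := by
  simp [coordDet, changeBasis, Matrix.det_fin_two]
  ring

theorem IsLatticeBasis.exists_changeBasis {M : Submodule (QuadRing D) (QuadAlg D)}
    {α β : Fin 2 → QuadAlg D} (h : IsLatticeBasis M α) (hβ : ∀ i, β i ∈ M) :
    ∃ g : Matrix (Fin 2) (Fin 2) ℤ, β = changeBasis g α := by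
  choose m n hmn using fun i => (h (β i)).mp (hβ i)
  exact ⟨Matrix.of fun i => ![m i, n i], by funext i; simp [changeBasis, hmn i]⟩

namespace IsOrientedBasis

variable {I J L : OrientedIdeal D} {α β γ : Fin 2 → QuadAlg D}

theorem lattice (h : IsOrientedBasis I α) : IsLatticeBasis I.ideal α := h.1

theorem det_ne_zero (h : IsOrientedBasis I α) : coordDet α ≠ 0 := by
  intro h0
  have h1 := h.2
  rw [h0, sign_zero] at h1
  exact I.2.ne_zero h1.symm

theorem unique (h : IsOrientedBasis I α) (h' : IsOrientedBasis J α) : I = J := by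
  apply Prod.ext
  · apply Units.ext
    exact h.lattice.eq h'.lattice
  · apply Units.ext
    exact h.2.symm.trans h'.2

theorem exists_hasForm (h : IsOrientedBasis I α) : ∃ f : BinForm, f.IsPrimitive ∧ HasForm f α :=
  IsLatticeBasis.exists_hasForm (U := I.1) h.1 h.det_ne_zero

/-- The inverse of an oriented ideal has the reciprocal norm, see `coordDet_dualBasis`. -/
theorem inv (hD : D % 4 = 0 ∨ D % 4 = 1) (h : IsOrientedBasis I α) :
    IsOrientedBasis I⁻¹ (dualBasis α) := by
  obtain ⟨f, hf, hfα⟩ := h.exists_hasForm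
  obtain ⟨J, hJ, hJ'⟩ := hfα.exists_orientedIdeal hD h.det_ne_zero hf
  rwa [h.unique hJ]

theorem changeBasis (h : IsOrientedBasis I α) (g : SL(2, ℤ)) :
    IsOrientedBasis I (changeBasis (g : Matrix (Fin 2) (Fin 2) ℤ) α) := by
  refine ⟨fun x => ?_, ?_⟩
  · constructor
    · intro hx
      have e : α = _root_.changeBasis (g⁻¹ : SL(2, ℤ)).1 (_root_.changeBasis g.1 α) := by
        rw [changeBasis_changeBasis, ← Matrix.SpecialLinearGroup.coe_mul, inv_mul_cancel,
          Matrix.SpecialLinearGroup.coe_one, changeBasis_one]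
      obtain ⟨m, n, rfl⟩ := (h.1 x).mp hx
      generalize _root_.changeBasis g.1 α = β at e
      rw [e]
      refine ⟨m * (g⁻¹ : SL(2, ℤ)).1 0 0 + n * (g⁻¹ : SL(2, ℤ)).1 1 0,
        m * (g⁻¹ : SL(2, ℤ)).1 0 1 + n * (g⁻¹ : SL(2, ℤ)).1 1 1, ?_⟩
      simp only [_root_.changeBasis, zsmul_eq_mul]
      push_cast
      ring
    · rintro ⟨m, n, rfl⟩
      have hm : ∀ i, _root_.changeBasis g.1 α i ∈ I.ideal := fun i =>
        add_mem (zsmul_mem (h.lattice.mem 0) _) (zsmul_mem (h.lattice.mem 1) _)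
      exact add_mem (zsmul_mem (hm 0) _) (zsmul_mem (hm 1) _)
  · rw [coordDet_changeBasis, g.det_coe, Int.cast_one, one_mul]
    exact h.2

/-- Two oriented bases of an oriented ideal differ by a matrix in `SL(2, ℤ)`. -/
theorem exists_changeBasis (h : IsOrientedBasis I α) (h' : IsOrientedBasis I β) :
    ∃ g : SL(2, ℤ), β = _root_.changeBasis (g : Matrix (Fin 2) (Fin 2) ℤ) α := by
  obtain ⟨g, hg⟩ := h.lattice.exists_changeBasis fun i => h'.lattice.mem i
  obtain ⟨k, hk⟩ := h'.lattice.exists_changeBasis fun i => h.lattice.mem i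
  have h1 : coordDet β = g.det * coordDet α := by rw [hg, coordDet_changeBasis]
  have h2 : coordDet α = k.det * coordDet β := by
    conv_lhs => rw [hk]
    rw [coordDet_changeBasis]
  have h3 : g.det * k.det = 1 := by
    have : ((g.det * k.det : ℤ) : ℚ) = 1 := by
      apply mul_right_cancel₀ h.det_ne_zero
      rw [Int.cast_mul]
      linear_combination -k.det * h1 - h2
    exact_mod_cast this
  refine ⟨⟨g, ?_⟩, hg⟩
  rcases Int.isUnit_iff.mp (IsUnit.of_mul_eq_one _ h3) with h4 | h4
  · exact h4
  · have h5 := h'.2.trans h.2.symm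
    rw [h1, h4] at h5
    push_cast at h5
    rw [neg_one_mul, Left.sign_neg] at h5
    exfalso
    have h6 := h.det_ne_zero
    rw [← sign_ne_zero] at h6
    revert h5 h6
    generalize SignType.sign (coordDet α) = s
    revert s
    decide

end IsOrientedBasis

theorem OrientedIdeal.exists_basis (I : OrientedIdeal D) : ∃ α, IsOrientedBasis I α := by
  obtain ⟨α, hα, hdet⟩ := exists_latticeBasis I.1
  by_cases hs : SignType.sign (coordDet α) = I.orientation
  · exact ⟨α, hα, hs⟩
  · refine ⟨![α 1, α 0], fun x => ?_, ?_⟩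
    · change x ∈ I.1.1 ↔ _
      rw [hα x]
      constructor
      · rintro ⟨m, n, rfl⟩; exact ⟨n, m, by simp [add_comm]⟩
      · rintro ⟨m, n, rfl⟩; exact ⟨n, m, by simp [add_comm]⟩
    · have : coordDet ![α 1, α 0] = -coordDet α := by simp [coordDet]; ring
      rw [this, Left.sign_neg]
      have h6 := I.2.ne_zero
      change I.orientation ≠ 0 at h6
      rw [← sign_ne_zero] at hdet
      revert hs h6 hdet
      generalize SignType.sign (coordDet α) = s
      generalize I.orientation = s'
      revert s s'
      decide

/-! ### Cubes attached to triples of bases -/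

/-- `α_A β_B γ_C` has `τ`-coordinate `a_{ABC}` and integral `1`-coordinate. -/
def IsCubeOf (q : ChargeCube) (α β γ : Fin 2 → QuadAlg D) : Prop :=
  ∃ c : Fin 2 → Fin 2 → Fin 2 → ℤ, ∀ A B C : Fin 2,
    α A * β B * γ C = ⟨(c A B C : ℚ), (q.coeff A B C : ℚ)⟩

namespace ChargeCube

theorem disc_formS (q : ChargeCube) : q.formS.disc = q.hyperdet := by
  simp only [BinForm.disc, formS, hyperdet]; ring

/-- The cube with the first two indices exchanged. -/
def swapST (q : ChargeCube) : ChargeCube := ⟨fun A B C => q.coeff B A C⟩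

/-- The cube with the first and third indices exchanged. -/
def swapSU (q : ChargeCube) : ChargeCube := ⟨fun A B C => q.coeff C B A⟩

theorem formS_swapST (q : ChargeCube) : q.swapST.formS = q.formT := by
  simp only [formS, formT, swapST, BinForm.mk.injEq]
  refine ⟨?_, ?_, ?_⟩ <;> ring

theorem formS_swapSU (q : ChargeCube) : q.swapSU.formS = q.formU := by
  simp only [formS, formU, swapSU, BinForm.mk.injEq]
  refine ⟨?_, ?_, ?_⟩ <;> ring

theorem hyperdet_swapST (q : ChargeCube) : q.swapST.hyperdet = q.hyperdet := by
  simp only [hyperdet, swapST]; ring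

end ChargeCube

namespace IsCubeOf

variable {q : ChargeCube} {α β γ : Fin 2 → QuadAlg D}

theorem swapST (h : IsCubeOf q α β γ) : IsCubeOf q.swapST β α γ := by
  obtain ⟨c, hc⟩ := h
  exact ⟨fun A B C => c B A C, fun A B C => by rw [mul_comm (β A), hc]; rfl⟩

theorem swapSU (h : IsCubeOf q α β γ) : IsCubeOf q.swapSU γ β α := by
  obtain ⟨c, hc⟩ := h
  exact ⟨fun A B C => c C B A, fun A B C => by
    rw [mul_comm, ← mul_assoc, mul_right_comm, hc]; rfl⟩

/-- The form of the first slot is the norm form of the first lattice, up to a constant. -/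
theorem eval_formS (h : IsCubeOf q α β γ) (x y : ℤ) :
    (q.formS.eval x y : ℚ) = -(coordDet β * coordDet γ * (x • α 0 + y • α 1).norm) := by
  obtain ⟨c, hc⟩ := h
  have him : ∀ A B C, (q.coeff A B C : ℚ) = (α A * β B * γ C).im := fun A B C => by rw [hc]
  set w := x • α 0 + y • α 1 with hw
  have hlin : ∀ B C, (x * q.coeff 0 B C + y * q.coeff 1 B C : ℚ) = (w * (β B * γ C)).im := by
    intro B C
    rw [him, him, hw]
    simp only [zsmul_eq_mul, im_add, im_mul, re_mul, re_add, re_intCast, im_intCast]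
    ring
  have e : (q.formS.eval x y : ℚ) =
      (x * q.coeff 0 0 0 + y * q.coeff 1 0 0) * (x * q.coeff 0 1 1 + y * q.coeff 1 1 1)
      - (x * q.coeff 0 0 1 + y * q.coeff 1 0 1) * (x * q.coeff 0 1 0 + y * q.coeff 1 1 0) := by
    simp only [BinForm.eval, ChargeCube.formS]
    push_cast
    ring
  -- The bilinear form `im (w * y * z)` has determinant `-N(w)` in the basis `(1, τ)`.
  rw [e, hlin, hlin, hlin, hlin, norm_def]
  simp only [im_mul, re_mul, coordDet]
  ring

/-- If the product of the determinants is `1`, the form of the first slot is the opposite of the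
form of the first lattice. -/
theorem hasForm (h : IsCubeOf q α β γ) (hP : coordDet α * coordDet β * coordDet γ = 1) :
    HasForm q.formS.neg α := by
  have hα : coordDet α ≠ 0 := by
    intro h0; rw [h0] at hP; simp at hP
  refine hasForm_of_norm_eq hα fun x y => ?_
  rw [BinForm.eval_neg]
  push_cast
  rw [h.eval_formS]
  linear_combination -(x • α 0 + y • α 1).norm * hP

end IsCubeOf

theorem exists_cube {α β γ : Fin 2 → QuadAlg D}
    (h : ∀ A B C, α A * β B * γ C ∈ (1 : Submodule (QuadRing D) (QuadAlg D))) :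
    ∃ q, IsCubeOf q α β γ := by
  choose c a h using fun A B C => (mem_one_iff _).mp (h A B C)
  exact ⟨⟨a⟩, c, h⟩

theorem HasForm.unique {f g : BinForm} {α : Fin 2 → QuadAlg D} (hα : coordDet α ≠ 0)
    (hf : HasForm f α) (hg : HasForm g α) : f = g := by
  have key : ∀ x y : ℤ, f.eval x y = g.eval x y := fun x y => by
    have : (f.eval x y : ℚ) = g.eval x y := by
      apply mul_right_cancel₀ hα
      rw [← hf.norm_eq, hg.norm_eq]
    exact_mod_cast this
  have h1 := key 1 0
  have h2 := key 0 1
  have h3 := key 1 1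
  simp [BinForm.eval] at h1 h2 h3
  cases f; cases g
  simp only [BinForm.mk.injEq] at *
  omega

/-! ### The norm of oriented ideals is multiplicative -/

section Norm

variable {I J L : OrientedIdeal D} {α β γ : Fin 2 → QuadAlg D}

theorem mul_mem_one_of_le (hα : IsOrientedBasis I α) (hβ : IsOrientedBasis J β)
    (hγ : IsOrientedBasis L γ) (h : I.ideal * J.ideal * L.ideal ≤ 1) (A B C : Fin 2) :
    α A * β B * γ C ∈ (1 : Submodule (QuadRing D) (QuadAlg D)) :=
  h (Submodule.mul_mem_mul (Submodule.mul_mem_mul (hα.lattice.mem A) (hβ.lattice.mem B))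
    (hγ.lattice.mem C))

/-- If `I J L ⊆ S`, the product of the norms is an integer: it is the factor by which the form
of a slot of the cube differs from a primitive form. -/
theorem exists_int_eq_norm (hα : IsOrientedBasis I α) (hβ : IsOrientedBasis J β)
    (hγ : IsOrientedBasis L γ) (h : I.ideal * J.ideal * L.ideal ≤ 1) :
    ∃ m : ℤ, coordDet α * coordDet β * coordDet γ = m := by
  obtain ⟨q, hq⟩ := exists_cube (mul_mem_one_of_le hα hβ hγ h)
  obtain ⟨f, hf, hfα⟩ := hα.exists_hasForm
  obtain ⟨u, v, w, huvw⟩ := hf.exists_bezout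
  have h1 := hq.eval_formS 1 0
  have h2 := hq.eval_formS 0 1
  have h3 := hq.eval_formS 1 1
  rw [hfα.norm_eq] at h1 h2 h3
  simp only [BinForm.eval] at h1 h2 h3
  refine ⟨-(u * q.formS.a + v * q.formS.b + w * q.formS.c), ?_⟩
  have huvw' : (u * f.a + v * f.b + w * f.c : ℚ) = 1 := by exact_mod_cast huvw
  push_cast at *
  linear_combination -coordDet α * coordDet β * coordDet γ * huvw' + (u : ℚ) * h1
    + (v : ℚ) * (h3 - h1 - h2) + (w : ℚ) * h2

theorem ideal_mul (I J : OrientedIdeal D) : (I * J).ideal = I.ideal * J.ideal := rfl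

theorem orientation_mul (I J : OrientedIdeal D) :
    (I * J).orientation = I.orientation * J.orientation := rfl

/-- Multiplicativity of the norm. The product of the norms and its inverse are both
integers. -/
theorem norm_eq_one_of_mul_eq_one (hD : D % 4 = 0 ∨ D % 4 = 1) (hα : IsOrientedBasis I α)
    (hβ : IsOrientedBasis J β) (hγ : IsOrientedBasis L γ) (h : I * J * L = 1) :
    coordDet α * coordDet β * coordDet γ = 1 := by
  have h1 : I.ideal * J.ideal * L.ideal ≤ 1 := by
    rw [← ideal_mul, ← ideal_mul, h]; exact le_rfl
  have h2 : I⁻¹.ideal * J⁻¹.ideal * L⁻¹.ideal ≤ 1 := by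
    rw [← ideal_mul, ← ideal_mul, ← mul_inv, ← mul_inv, h, inv_one]; exact le_rfl
  obtain ⟨m, hm⟩ := exists_int_eq_norm hα hβ hγ h1
  obtain ⟨n, hn⟩ := exists_int_eq_norm (hα.inv hD) (hβ.inv hD) (hγ.inv hD) h2
  rw [coordDet_dualBasis, coordDet_dualBasis, coordDet_dualBasis, ← mul_inv, ← mul_inv, hm] at hn
  have hm0 : (m : ℚ) ≠ 0 := by
    rw [← hm]; exact mul_ne_zero (mul_ne_zero hα.det_ne_zero hβ.det_ne_zero) hγ.det_ne_zero
  have hmn : m * n = 1 := by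
    have : (m * n : ℚ) = 1 := by rw [← hn, mul_inv_cancel₀ hm0]
    exact_mod_cast this
  have hs : SignType.sign (coordDet α * coordDet β * coordDet γ) = 1 := by
    rw [sign_mul, sign_mul, hα.2, hβ.2, hγ.2, ← orientation_mul, ← orientation_mul, h]; rfl
  rw [hm]
  rw [hm, sign_eq_one_iff] at hs
  rcases Int.isUnit_iff.mp (IsUnit.of_mul_eq_one _ hmn) with h4 | h4
  · rw [h4, Int.cast_one]
  · rw [h4] at hs; norm_num at hs

theorem IsBalanced.of_mul_eq_one (hD : D % 4 = 0 ∨ D % 4 = 1) (h : I * J * L = 1) :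
    IsBalanced I J L := by
  obtain ⟨α, hα⟩ := I.exists_basis
  obtain ⟨β, hβ⟩ := J.exists_basis
  obtain ⟨γ, hγ⟩ := L.exists_basis
  exact ⟨by rw [← ideal_mul, ← ideal_mul, h]; exact le_rfl, α, β, γ, hα, hβ, hγ,
    norm_eq_one_of_mul_eq_one hD hα hβ hγ h⟩

/-- A triple is balanced exactly when its product is trivial in the group of oriented ideals. -/
theorem isBalanced_iff (hD : D % 4 = 0 ∨ D % 4 = 1) : IsBalanced I J L ↔ I * J * L = 1 := by
  refine ⟨?_, IsBalanced.of_mul_eq_one hD⟩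
  rintro ⟨h, α, β, γ, hα, hβ, hγ, hP⟩
  obtain ⟨μ, hμ⟩ := (I * J)⁻¹.exists_basis
  have hP' := norm_eq_one_of_mul_eq_one hD hα hβ hμ (mul_inv_cancel _)
  have hle : L.ideal ≤ (I * J)⁻¹.ideal := by
    have h1 : (I * J).ideal * (I * J)⁻¹.ideal = 1 := (I * J).1.mul_inv
    calc L.ideal = L.ideal * ((I * J).ideal * (I * J)⁻¹.ideal) := by rw [h1, mul_one]
      _ = I.ideal * J.ideal * L.ideal * (I * J)⁻¹.ideal := by rw [ideal_mul]; ring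
      _ ≤ 1 * (I * J)⁻¹.ideal := by gcongr
      _ = (I * J)⁻¹.ideal := one_mul _
  obtain ⟨g, hg⟩ := hμ.lattice.exists_changeBasis fun i => hle (hγ.lattice.mem i)
  have hdet : g.det = 1 := by
    have h2 : coordDet γ = g.det * coordDet μ := by rw [hg, coordDet_changeBasis]
    have : (g.det : ℚ) = 1 := by
      linear_combination -g.det * hP' + hP - coordDet α * coordDet β * h2
    exact_mod_cast this
  have hγ' : IsOrientedBasis (I * J)⁻¹ γ := by
    rw [hg]; exact hμ.changeBasis ⟨g, hdet⟩
  rw [hγ.unique hγ', mul_inv_cancel]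

end Norm

/-! ### The triple attached to a cube -/

theorem IsCubeOf.changeBasis {q : ChargeCube} {α β γ : Fin 2 → QuadAlg D} (h : IsCubeOf q α β γ)
    (g : UDuality) : IsCubeOf (g • q) (changeBasis g.1.1 α) (changeBasis g.2.1.1 β)
      (changeBasis g.2.2.1 γ) := by
  obtain ⟨c, hc⟩ := h
  refine ⟨fun A B C => ∑ A' : Fin 2, ∑ B' : Fin 2, ∑ C' : Fin 2,
    g.1 A A' * g.2.1 B B' * g.2.2 C C' * c A' B' C', fun A B C => ?_⟩
  have e : _root_.changeBasis g.1.1 α A * _root_.changeBasis g.2.1.1 β B *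
      _root_.changeBasis g.2.2.1 γ C =
      ∑ A' : Fin 2, ∑ B' : Fin 2, ∑ C' : Fin 2,
        ((g.1 A A' * g.2.1 B B' * g.2.2 C C' : ℤ) : QuadAlg D) * (α A' * β B' * γ C') := by
    simp only [_root_.changeBasis, Fin.sum_univ_two, zsmul_eq_mul]
    push_cast
    ring
  have hq : (g • q).coeff A B C = ∑ A' : Fin 2, ∑ B' : Fin 2, ∑ C' : Fin 2,
    g.1 A A' * g.2.1 B B' * g.2.2 C C' * q.coeff A' B' C' := rfl
  rw [e, hq]
  simp only [hc, Fin.sum_univ_two]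
  ext
  · simp only [re_add, re_mul, re_intCast, im_intCast]
    push_cast
    ring
  · simp only [im_add, im_mul, re_intCast, im_intCast]
    push_cast
    ring

theorem IsCubeOf.unique {q q' : ChargeCube} {α β γ : Fin 2 → QuadAlg D} (h : IsCubeOf q α β γ)
    (h' : IsCubeOf q' α β γ) : q = q' := by
  obtain ⟨c, hc⟩ := h
  obtain ⟨c', hc'⟩ := h'
  ext A B C
  have := congrArg QuadraticAlgebra.im ((hc A B C).symm.trans (hc' A B C))
  exact Int.cast_injective this

theorem IsCubeOf.mul {q : ChargeCube} {α β γ : Fin 2 → QuadAlg D} (h : IsCubeOf q α β γ)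
    {κ μ ν : QuadAlg D} (hκ : κ * μ * ν = 1) :
    IsCubeOf q (fun i => κ * α i) (fun i => μ * β i) (fun i => ν * γ i) := by
  obtain ⟨c, hc⟩ := h
  refine ⟨c, fun A B C => ?_⟩
  rw [← hc]
  linear_combination α A * β B * γ C * hκ

/-- The rational parts of an eigenvector are determined by its `τ`-coordinates. -/
theorem hasForm_of_im (hD : D % 4 = 0 ∨ D % 4 = 1) {f : BinForm} (hf : f.disc = D)
    {α : Fin 2 → QuadAlg D} {c₀ c₁ a₀ a₁ : ℤ} (hα₀ : α 0 = ⟨(c₀ : ℚ), (a₀ : ℚ)⟩)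
    (hα₁ : α 1 = ⟨(c₁ : ℚ), (a₁ : ℚ)⟩) (h0 : 2 * c₀ + D % 4 * a₀ = -f.b * a₀ + 2 * f.a * a₁)
    (h1 : 2 * c₁ + D % 4 * a₁ = -2 * f.c * a₀ + f.b * a₁) : HasForm f α := by
  have e := cast_disc hD
  have hf' : (f.b : ℚ) ^ 2 - 4 * f.a * f.c = D := by
    rw [BinForm.disc] at hf; exact_mod_cast hf
  have h0' : (2 * c₀ + (D % 4 : ℤ) * a₀ : ℚ) = -f.b * a₀ + 2 * f.a * a₁ := by exact_mod_cast h0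
  have h1' : (2 * c₁ + (D % 4 : ℤ) * a₁ : ℚ) = -2 * f.c * a₀ + f.b * a₁ := by exact_mod_cast h1
  rw [HasForm.iff_coord, hα₀, hα₁]
  refine ⟨⟨?_, h0'⟩, ?_, h1'⟩
  · linear_combination (-((D % 4 : ℤ) : ℚ) + f.b) / 2 * h0' - f.a * h1'
      - (a₀ : ℚ) / 2 * e - (a₀ : ℚ) / 2 * hf'
  · linear_combination (-((D % 4 : ℤ) : ℚ) - f.b) / 2 * h1' + f.c * h0'
      - (a₁ : ℚ) / 2 * e - (a₁ : ℚ) / 2 * hf'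

/-- A form of discriminant `D` has `b ≡ D (mod 2)`. -/
theorem BinForm.exists_half {f : BinForm} (hf : f.disc = D) :
    ∃ k : ℤ, D % 4 = 2 * k + f.b := by
  have : HasForm f (0 : Fin 2 → QuadAlg D) := ⟨by simp, by simp⟩
  obtain ⟨k, hk, -⟩ := this.tau_mul hf
  exact ⟨k, hk⟩

/-- The `τ`-coordinates of a cube of discriminant `D` extend to a tensor over `K` whose
slices in the first and the second direction are eigenvectors for `-f_S` and `-f_T`. -/
theorem exists_tensor (hD : D % 4 = 0 ∨ D % 4 = 1) {q : ChargeCube} (hq : q.hyperdet = D) :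
    ∃ u : Fin 2 → Fin 2 → Fin 2 → QuadAlg D,
      (∃ c : Fin 2 → Fin 2 → Fin 2 → ℤ, ∀ A B C, u A B C = ⟨(c A B C : ℚ), (q.coeff A B C : ℚ)⟩) ∧
      (∀ B C, HasForm q.formS.neg (fun A => u A B C)) ∧
      (∀ A C, HasForm q.formT.neg (fun B => u A B C)) := by
  have hS : q.formS.neg.disc = D := by rw [BinForm.disc_neg, q.disc_formS, hq]
  have hT : q.formT.neg.disc = D := by
    rw [BinForm.disc_neg, ← q.formS_swapST, q.swapST.disc_formS, q.hyperdet_swapST, hq]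
  obtain ⟨k, hk⟩ := BinForm.exists_half hS
  -- The `τ`-coordinates of `√D u_A = ∑ M_{AA'} u_{A'}` can be solved for `c`, integrally since
  -- `b ≡ D (mod 2)`.
  let c : Fin 2 → Fin 2 → Fin 2 → ℤ := fun A B C =>
    ![q.formS.neg.a * q.coeff 1 B C - (k + q.formS.neg.b) * q.coeff 0 B C,
      -q.formS.neg.c * q.coeff 0 B C - k * q.coeff 1 B C] A
  have hc0 : ∀ B C, 2 * c 0 B C = -q.formS.neg.b * q.coeff 0 B C
      + 2 * q.formS.neg.a * q.coeff 1 B C - (D % 4) * q.coeff 0 B C := fun B C => by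
    simp only [c, hk, Matrix.cons_val_zero]; ring
  have hc1 : ∀ B C, 2 * c 1 B C = -2 * q.formS.neg.c * q.coeff 0 B C
      + q.formS.neg.b * q.coeff 1 B C - (D % 4) * q.coeff 1 B C := fun B C => by
    simp only [c, hk, Matrix.cons_val_one]
    simp; ring
  refine ⟨fun A B C => ⟨(c A B C : ℚ), (q.coeff A B C : ℚ)⟩, ⟨c, fun A B C => rfl⟩, ?_, ?_⟩
  · intro B C
    exact hasForm_of_im hD hS rfl rfl (by linear_combination hc0 B C)
      (by linear_combination hc1 B C)
  · intro A C
    have h0 : 2 * c A 0 C + (D % 4) * q.coeff A 0 C =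
        -q.formT.neg.b * q.coeff A 0 C + 2 * q.formT.neg.a * q.coeff A 1 C := by
      fin_cases A <;> fin_cases C
      · linear_combination (norm := skip) hc0 0 0
        simp [BinForm.neg, ChargeCube.formS, ChargeCube.formT]; ring
      · linear_combination (norm := skip) hc0 0 1
        simp [BinForm.neg, ChargeCube.formS, ChargeCube.formT]; ring
      · linear_combination (norm := skip) hc1 0 0
        simp [BinForm.neg, ChargeCube.formS, ChargeCube.formT]; ring
      · linear_combination (norm := skip) hc1 0 1
        simp [BinForm.neg, ChargeCube.formS, ChargeCube.formT]; ring
    have h1 : 2 * c A 1 C + (D % 4) * q.coeff A 1 C =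
        -2 * q.formT.neg.c * q.coeff A 0 C + q.formT.neg.b * q.coeff A 1 C := by
      fin_cases A <;> fin_cases C
      · linear_combination (norm := skip) hc0 1 0
        simp [BinForm.neg, ChargeCube.formS, ChargeCube.formT]; ring
      · linear_combination (norm := skip) hc0 1 1
        simp [BinForm.neg, ChargeCube.formS, ChargeCube.formT]; ring
      · linear_combination (norm := skip) hc1 1 0
        simp [BinForm.neg, ChargeCube.formS, ChargeCube.formT]; ring
      · linear_combination (norm := skip) hc1 1 1
        simp [BinForm.neg, ChargeCube.formS, ChargeCube.formT]; ring
    exact hasForm_of_im hD hT rfl rfl h0 h1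

/-- Every cube of discriminant `D` arises from three pairs of elements of `K`: the tensor of
`exists_tensor` has rank one. -/
theorem exists_bases (hD0 : D ≠ 0) (hD : D % 4 = 0 ∨ D % 4 = 1) {q : ChargeCube}
    (hq : q.hyperdet = D) : ∃ α β γ : Fin 2 → QuadAlg D, IsCubeOf q α β γ ∧
      coordDet α * coordDet β * coordDet γ = 1 := by
  obtain ⟨u, ⟨c, hc⟩, uS, uT⟩ := exists_tensor hD hq
  have hS : q.formS.neg.disc = D := by rw [BinForm.disc_neg, q.disc_formS, hq]
  have hT : q.formT.neg.disc = D := by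
    rw [BinForm.disc_neg, ← q.formS_swapST, q.swapST.disc_formS, q.hyperdet_swapST, hq]
  obtain ⟨α, hα, hα0⟩ := exists_hasForm hD0 hD hS
  obtain ⟨β, hβ, hβ0⟩ := exists_hasForm hD0 hD hT
  obtain ⟨x, y, hxy, v, hv⟩ := hα.exists_isUnit hD0 hD hα0
  obtain ⟨x', y', -, w, hw⟩ := hβ.exists_isUnit hD0 hD hβ0
  simp only [zsmul_eq_mul] at hv hw
  -- For `v = x α₀ + y α₁` and `w = x' β₀ + y' β₁`, divide the combination of the `u_{ABC}` with the
  -- coefficients of `v w` by `v w`; both are invertible, while `α₀` and `β₀` need not be.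
  let γ : Fin 2 → QuadAlg D := fun C => ↑(v * w)⁻¹ * (x * x' * u 0 0 C + x * y' * u 0 1 C
    + y * x' * u 1 0 C + y * y' * u 1 1 C)
  have hcube : IsCubeOf q α β γ := by
    refine ⟨c, fun A B C => ?_⟩
    rw [← hc]
    apply (v * w).isUnit.mul_left_cancel
    have e : (↑(v * w) : QuadAlg D) * (α A * β B * γ C) = α A * β B * (x * x' * u 0 0 C
        + x * y' * u 0 1 C + y * x' * u 1 0 C + y * y' * u 1 1 C) := by
      simp only [γ]
      rw [mul_left_comm, ← mul_assoc (↑(v * w) : QuadAlg D), Units.mul_inv, one_mul]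
    rw [e, Units.val_mul, hv, hw]
    have a1 := fun A' B' => hα.cross_eq' hD0 hD (uS B' C) A A'
    have b1 := fun A' B' => hβ.cross_eq' hD0 hD (uT A' C) B B'
    linear_combination α A * x * x' * b1 0 0 + α A * x * y' * b1 0 1 + α A * y * x' * b1 1 0
      + α A * y * y' * b1 1 1 + (x' * β 0 + y' * β 1) * (x * a1 0 B + y * a1 1 B)
  refine ⟨α, β, γ, hcube, ?_⟩
  have h1 := hcube.eval_formS x y
  rw [hα.norm_eq, BinForm.eval_neg] at h1
  rw [BinForm.eval_neg, neg_ne_zero] at hxy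
  have hxy' : (q.formS.eval x y : ℚ) ≠ 0 := by exact_mod_cast hxy
  apply mul_left_cancel₀ hxy'
  push_cast at h1
  linear_combination -h1

/-! ### The correspondence between cube classes and pairs of narrow ideal classes -/

theorem CorrespondsTo.mul_eq_one (hD : D % 4 = 0 ∨ D % 4 = 1) {q : ChargeCube}
    {I J L : OrientedIdeal D} (h : CorrespondsTo q I J L) : I * J * L = 1 :=
  (isBalanced_iff hD).mp h.1

theorem CorrespondsTo.of_bases (hD : D % 4 = 0 ∨ D % 4 = 1) {q : ChargeCube}
    {I J L : OrientedIdeal D} {α β γ : Fin 2 → QuadAlg D} (h : I * J * L = 1)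
    (hα : IsOrientedBasis I α) (hβ : IsOrientedBasis J β) (hγ : IsOrientedBasis L γ)
    (hq : IsCubeOf q α β γ) : CorrespondsTo q I J L :=
  ⟨.of_mul_eq_one hD h, α, β, γ, hα, hβ, hγ, hq⟩

theorem CorrespondsTo.swapST (hD : D % 4 = 0 ∨ D % 4 = 1) {q : ChargeCube}
    {I J L : OrientedIdeal D} (h : CorrespondsTo q I J L) : CorrespondsTo q.swapST J I L := by
  obtain ⟨-, α, β, γ, hα, hβ, hγ, hq⟩ := id h
  exact .of_bases hD (by rw [mul_comm J, h.mul_eq_one hD]) hβ hα hγ (IsCubeOf.swapST hq)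

theorem CorrespondsTo.swapSU (hD : D % 4 = 0 ∨ D % 4 = 1) {q : ChargeCube}
    {I J L : OrientedIdeal D} (h : CorrespondsTo q I J L) : CorrespondsTo q.swapSU L J I := by
  obtain ⟨-, α, β, γ, hα, hβ, hγ, hq⟩ := id h
  exact .of_bases hD (by rw [mul_comm, ← mul_assoc, mul_right_comm, h.mul_eq_one hD]) hγ hβ hα
    (IsCubeOf.swapSU hq)

theorem CorrespondsTo.smul (hD : D % 4 = 0 ∨ D % 4 = 1) {q : ChargeCube}
    {I J L : OrientedIdeal D} (h : CorrespondsTo q I J L) (g : UDuality) :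
    CorrespondsTo (g • q) I J L := by
  obtain ⟨-, α, β, γ, hα, hβ, hγ, hq⟩ := id h
  exact .of_bases hD (h.mul_eq_one hD) (hα.changeBasis g.1) (hβ.changeBasis g.2.1)
    (hγ.changeBasis g.2.2) (IsCubeOf.changeBasis hq g)

/-- The form of the first ideal of a triple is `-f_S`. -/
theorem CorrespondsTo.exists_hasForm (hD : D % 4 = 0 ∨ D % 4 = 1) {q : ChargeCube}
    {I J L : OrientedIdeal D} (h : CorrespondsTo q I J L) :
    ∃ α, IsOrientedBasis I α ∧ HasForm q.formS.neg α := by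
  obtain ⟨-, α, β, γ, hα, hβ, hγ, hq⟩ := id h
  exact ⟨α, hα, IsCubeOf.hasForm hq (norm_eq_one_of_mul_eq_one hD hα hβ hγ (h.mul_eq_one hD))⟩

theorem CorrespondsTo.isPrimitive_formS (hD : D % 4 = 0 ∨ D % 4 = 1) {q : ChargeCube}
    {I J L : OrientedIdeal D} (h : CorrespondsTo q I J L) : q.formS.IsPrimitive := by
  obtain ⟨α, hα, hf⟩ := h.exists_hasForm hD
  obtain ⟨f, hp, hf'⟩ := hα.exists_hasForm
  rw [hf'.unique hα.det_ne_zero hf] at hp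
  have := hp.neg
  rwa [BinForm.neg_neg] at this

theorem CorrespondsTo.isProjective (hD : D % 4 = 0 ∨ D % 4 = 1) {q : ChargeCube}
    {I J L : OrientedIdeal D} (h : CorrespondsTo q I J L) : q.IsProjective := by
  refine ⟨h.isPrimitive_formS hD, ?_, ?_⟩
  · rw [← q.formS_swapST]; exact (h.swapST hD).isPrimitive_formS hD
  · rw [← q.formS_swapSU]; exact (h.swapSU hD).isPrimitive_formS hD

theorem CorrespondsTo.hyperdet_eq (hD : D % 4 = 0 ∨ D % 4 = 1) {q : ChargeCube}
    {I J L : OrientedIdeal D} (h : CorrespondsTo q I J L) : q.hyperdet = D := by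
  obtain ⟨α, hα, hf⟩ := h.exists_hasForm hD
  rw [← q.disc_formS, ← BinForm.disc_neg, hf.disc_eq hD hα.det_ne_zero]

/-- The cube attached to a triple, as a projective cube. -/
theorem CorrespondsTo.proj (hD : D % 4 = 0 ∨ D % 4 = 1) {q : ChargeCube}
    {I J L : OrientedIdeal D} (h : CorrespondsTo q I J L) :
    q.quarticNorm = -D ∧ q.IsProjective :=
  ⟨by rw [ChargeCube.quarticNorm, h.hyperdet_eq hD], h.isProjective hD⟩

theorem exists_projCube (hD : D % 4 = 0 ∨ D % 4 = 1) {I J L : OrientedIdeal D}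
    (h : I * J * L = 1) : ∃ q : ProjCube D, CorrespondsTo q.1 I J L := by
  obtain ⟨hle, α, β, γ, hα, hβ, hγ, -⟩ := IsBalanced.of_mul_eq_one hD h
  obtain ⟨q, hq⟩ := exists_cube (mul_mem_one_of_le hα hβ hγ hle)
  have hc := CorrespondsTo.of_bases hD h hα hβ hγ hq
  exact ⟨⟨q, hc.proj hD⟩, hc⟩

/-- Every projective cube comes from a balanced triple of invertible oriented ideals. -/
theorem exists_triple (hD0 : D ≠ 0) (hD : D % 4 = 0 ∨ D % 4 = 1) (q : ProjCube D) :
    ∃ I J L : OrientedIdeal D, CorrespondsTo q.1 I J L := by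
  obtain ⟨q, hq, hS, hT, hU⟩ := q
  have hq' : q.hyperdet = D := by rw [ChargeCube.quarticNorm] at hq; linarith
  obtain ⟨α, β, γ, hc, hP⟩ := exists_bases hD0 hD hq'
  have hα : coordDet α ≠ 0 := fun h => by simp [h] at hP
  have hβ : coordDet β ≠ 0 := fun h => by simp [h] at hP
  have hγ : coordDet γ ≠ 0 := fun h => by simp [h] at hP
  have fS := hc.hasForm hP
  have fT := hc.swapST.hasForm (by rw [← hP]; ring)
  have fU := hc.swapSU.hasForm (by rw [← hP]; ring)
  rw [ChargeCube.formS_swapST] at fT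
  rw [ChargeCube.formS_swapSU] at fU
  obtain ⟨I, hI, -⟩ := fS.exists_orientedIdeal hD hα hS.neg
  obtain ⟨J, hJ, -⟩ := fT.exists_orientedIdeal hD hβ hT.neg
  obtain ⟨L, hL, -⟩ := fU.exists_orientedIdeal hD hγ hU.neg
  refine ⟨I, J, L, ⟨?_, α, β, γ, hI, hJ, hL, hP⟩, α, β, γ, hI, hJ, hL, hc⟩
  obtain ⟨c, hc⟩ := hc
  have h1 : ∀ A B C, α A * β B * γ C ∈ (1 : Submodule (QuadRing D) (QuadAlg D)) := fun A B C =>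
    (mem_one_iff _).mpr ⟨_, _, hc A B C⟩
  rw [Submodule.mul_le]
  intro x hx z hz
  induction hx using Submodule.mul_induction_on' with
  | mem_mul_mem a ha b hb =>
    obtain ⟨m, n, rfl⟩ := (hI.1 a).mp ha
    obtain ⟨m', n', rfl⟩ := (hJ.1 b).mp hb
    obtain ⟨r, s, rfl⟩ := (hL.1 z).mp hz
    have e : (m • α 0 + n • α 1) * (m' • β 0 + n' • β 1) * (r • γ 0 + s • γ 1) =
        ∑ A : Fin 2, ∑ B : Fin 2, ∑ C : Fin 2,
          (![m, n] A * ![m', n'] B * ![r, s] C) • (α A * β B * γ C) := by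
      simp only [Fin.sum_univ_two, zsmul_eq_mul]
      simp
      ring
    rw [e]
    exact sum_mem fun A _ => sum_mem fun B _ => sum_mem fun C _ => zsmul_mem (h1 A B C) _
  | add a _ b _ iha ihb => rw [add_mul]; exact add_mem iha ihb

/-- Multiplication of an oriented ideal by a principal one. -/
theorem IsOrientedBasis.principal_mul {I : OrientedIdeal D} {α : Fin 2 → QuadAlg D}
    (h : IsOrientedBasis I α) (κ : (QuadAlg D)ˣ) :
    IsOrientedBasis (principalOriented D κ * I) (fun i => (κ : QuadAlg D) * α i) := by
  refine ⟨fun x => ?_, ?_⟩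
  · change x ∈ Submodule.span (QuadRing D) {(κ : QuadAlg D)} * I.ideal ↔ _
    rw [Submodule.mem_span_singleton_mul]
    constructor
    · rintro ⟨y, hy, rfl⟩
      obtain ⟨m, n, rfl⟩ := (h.1 y).mp hy
      exact ⟨m, n, by simp only [zsmul_eq_mul]; ring⟩
    · rintro ⟨m, n, rfl⟩
      exact ⟨_, (h.1 _).mpr ⟨m, n, rfl⟩, by simp only [zsmul_eq_mul]; ring⟩
  · have e : coordDet (fun i => (κ : QuadAlg D) * α i) =
        QuadraticAlgebra.norm (κ : QuadAlg D) * coordDet α := by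
      simp only [coordDet, norm_def, re_mul, im_mul]
      ring
    rw [e, sign_mul, h.2]
    rfl

theorem narrowClass_principal_mul (κ : (QuadAlg D)ˣ) (I : OrientedIdeal D) :
    narrowClass (principalOriented D κ * I) = narrowClass I := by
  apply QuotientGroup.eq.mpr
  exact ⟨κ⁻¹, by rw [map_inv, mul_inv, mul_assoc, inv_mul_cancel, mul_one]⟩

theorem exists_principal_mul {I J : OrientedIdeal D} (h : narrowClass I = narrowClass J) :
    ∃ κ, J = principalOriented D κ * I := by
  obtain ⟨κ, hκ⟩ := QuotientGroup.eq.mp h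
  exact ⟨κ, by rw [hκ, mul_comm, mul_inv_cancel_left]⟩

theorem narrowClass_mul (I J : OrientedIdeal D) :
    narrowClass (I * J) = narrowClass I * narrowClass J := rfl

/-- The narrow class of an oriented ideal is determined by the form of an oriented basis. -/
theorem narrowClass_eq_of_hasForm (hD0 : D ≠ 0) (hD : D % 4 = 0 ∨ D % 4 = 1)
    {I J : OrientedIdeal D} {α β : Fin 2 → QuadAlg D} {f : BinForm} (hα : IsOrientedBasis I α)
    (hβ : IsOrientedBasis J β) (hf : HasForm f α) (hf' : HasForm f β) :
    narrowClass I = narrowClass J := by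
  obtain ⟨κ, hκ⟩ := hf.exists_unit hD0 hD hf' hα.det_ne_zero hβ.det_ne_zero
  have h := hα.principal_mul κ
  rw [← funext hκ] at h
  rw [← h.unique hβ, narrowClass_principal_mul]

theorem CorrespondsTo.narrowClass_eq (hD0 : D ≠ 0) (hD : D % 4 = 0 ∨ D % 4 = 1) {q : ChargeCube}
    {I J L I' J' L' : OrientedIdeal D} (h : CorrespondsTo q I J L)
    (h' : CorrespondsTo q I' J' L') : narrowClass I = narrowClass I' := by
  obtain ⟨α, hα, hf⟩ := h.exists_hasForm hD
  obtain ⟨α', hα', hf'⟩ := h'.exists_hasForm hD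
  exact narrowClass_eq_of_hasForm hD0 hD hα hα' hf hf'

/-- Triples with the same first two narrow classes have `SL(2, ℤ)³`-equivalent cubes. -/
theorem CorrespondsTo.exists_smul_eq (hD : D % 4 = 0 ∨ D % 4 = 1) {q q' : ChargeCube}
    {I J L I' J' L' : OrientedIdeal D} (h : CorrespondsTo q I J L)
    (h' : CorrespondsTo q' I' J' L') (hI : narrowClass I = narrowClass I')
    (hJ : narrowClass J = narrowClass J') : ∃ g : UDuality, g • q = q' := by
  obtain ⟨κ, rfl⟩ := exists_principal_mul hI
  obtain ⟨μ, rfl⟩ := exists_principal_mul hJ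
  have hL : L' = principalOriented D (κ * μ)⁻¹ * L := by
    have h1 := h.mul_eq_one hD
    have h2 := h'.mul_eq_one hD
    rw [← eq_inv_iff_mul_eq_one, eq_comm, inv_eq_iff_eq_inv] at h1 h2
    rw [h1, h2, map_inv, map_mul, mul_inv, mul_inv, mul_inv, mul_inv, mul_inv]
    ac_rfl
  subst hL
  obtain ⟨-, α, β, γ, hα, hβ, hγ, hq⟩ := h
  obtain ⟨-, α', β', γ', hα', hβ', hγ', hq'⟩ := h'
  obtain ⟨g₁, rfl⟩ := (hα.principal_mul κ).exists_changeBasis hα'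
  obtain ⟨g₂, rfl⟩ := (hβ.principal_mul μ).exists_changeBasis hβ'
  obtain ⟨g₃, rfl⟩ := (hγ.principal_mul (κ * μ)⁻¹).exists_changeBasis hγ'
  refine ⟨(g₁, g₂, g₃), IsCubeOf.unique (IsCubeOf.changeBasis (IsCubeOf.mul hq ?_) _) hq'⟩
  rw [← Units.val_mul, Units.mul_inv]

theorem CubeClass.mk_eq_iff {q q' : ProjCube D} :
    CubeClass.mk q = CubeClass.mk q' ↔ ∃ g : UDuality, g • q'.1 = q.1 :=
  Quotient.eq (r := projCubeSetoid D)

/-- The bijection from cube classes to pairs of narrow classes. -/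
theorem exists_cubeClass_equiv (hD0 : D ≠ 0) (hD : D % 4 = 0 ∨ D % 4 = 1) :
    ∃ e : CubeClass D ≃ NarrowClassGroup D × NarrowClassGroup D,
      ∀ (q : ProjCube D) (I J L : OrientedIdeal D), CorrespondsTo q.1 I J L →
        e (CubeClass.mk q) = (narrowClass I, narrowClass J) := by
  choose I J L h using exists_triple hD0 hD
  have key : ∀ (q : ProjCube D) (I' J' L' : OrientedIdeal D), CorrespondsTo q.1 I' J' L' →
      (narrowClass (I q), narrowClass (J q)) = (narrowClass I', narrowClass J') :=
    fun q I' J' L' h' => Prod.ext ((h q).narrowClass_eq hD0 hD h')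
      (((h q).swapST hD).narrowClass_eq hD0 hD (h'.swapST hD))
  let F : CubeClass D → NarrowClassGroup D × NarrowClassGroup D :=
    Quotient.lift (fun q => (narrowClass (I q), narrowClass (J q))) (by
      rintro q q' ⟨g, hg⟩
      have := (h q').smul hD g
      rw [show g • q'.1 = q.1 from hg] at this
      exact key q _ _ _ this)
  have hF : ∀ q, F (CubeClass.mk q) = (narrowClass (I q), narrowClass (J q)) := fun q => rfl
  refine ⟨Equiv.ofBijective F ⟨?_, ?_⟩, fun q I' J' L' h' => key q I' J' L' h'⟩
  · rintro ⟨q⟩ ⟨q'⟩ hqq'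
    change F (CubeClass.mk q) = F (CubeClass.mk q') at hqq'
    rw [hF, hF, Prod.mk.injEq] at hqq'
    exact CubeClass.mk_eq_iff.mpr
      ((h q').exists_smul_eq hD (h q) hqq'.1.symm hqq'.2.symm)
  · rintro ⟨⟨I'⟩, ⟨J'⟩⟩
    obtain ⟨q, hq⟩ := exists_projCube hD (mul_inv_cancel (I' * J'))
    exact ⟨CubeClass.mk q, key q _ _ _ hq⟩

/-! ### The identity cube -/

theorem isOrientedBasis_one : IsOrientedBasis (1 : OrientedIdeal D)
    ![(1 : QuadAlg D), (⟨0, 1⟩ : QuadAlg D)] := by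
  refine ⟨fun x => ?_, ?_⟩
  · change x ∈ (1 : Submodule (QuadRing D) (QuadAlg D)) ↔ _
    rw [mem_one_iff]
    have e : ∀ m n : ℤ, (⟨(m : ℚ), (n : ℚ)⟩ : QuadAlg D) =
        m • ![(1 : QuadAlg D), (⟨0, 1⟩ : QuadAlg D)] 0
          + n • ![(1 : QuadAlg D), (⟨0, 1⟩ : QuadAlg D)] 1 := fun m n => by
      ext <;> simp
    simp only [e]
  · have : coordDet ![(1 : QuadAlg D), (⟨0, 1⟩ : QuadAlg D)] = 1 := by simp [coordDet]
    rw [this, sign_one]; rfl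

/-- The identity cube belongs to three unit ideals, each with the basis `(1, τ)`. -/
theorem idCube_correspondsTo (hD : D % 4 = 0 ∨ D % 4 = 1) :
    CorrespondsTo (idCube D) (1 : OrientedIdeal D) 1 1 := by
  refine .of_bases hD (by simp) isOrientedBasis_one isOrientedBasis_one isOrientedBasis_one ?_
  obtain ⟨q, hq⟩ := exists_cube (α := ![(1 : QuadAlg D), (⟨0, 1⟩ : QuadAlg D)])
    (mul_mem_one_of_le isOrientedBasis_one isOrientedBasis_one isOrientedBasis_one
      (by change (1 : Submodule (QuadRing D) (QuadAlg D)) * 1 * 1 ≤ 1; simp))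
  have : q = idCube D := by
    obtain ⟨c, hc⟩ := hq
    ext A B C
    have h1 := congrArg QuadraticAlgebra.im (hc A B C)
    apply Int.cast_injective (α := ℚ)
    refine h1.symm.trans ?_
    have h3 : D % 4 = 1 → (((D + 3) / 4 : ℤ) : ℚ) = ((D / 4 : ℤ) : ℚ) + 1 := fun h => by
      have : (D + 3) / 4 = D / 4 + 1 := by omega
      rw [this]; push_cast; rfl
    rcases hD with h | h
    · fin_cases A <;> fin_cases B <;> fin_cases C <;> simp [idCube, h]
    · fin_cases A <;> fin_cases B <;> fin_cases C <;> simp [idCube, h, h3]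
  rwa [← this]

/-! ### Finiteness -/

/-- A change of oriented basis acts on the form by substitution. -/
theorem HasForm.exists_changeBasis {f : BinForm} {α : Fin 2 → QuadAlg D} (h : HasForm f α)
    {I : OrientedIdeal D} (hα : IsOrientedBasis I α) (g : SL(2, ℤ)) :
    ∃ f' : BinForm, HasForm f' (changeBasis g.1 α) ∧
      ∀ x y, f'.eval x y = f.eval (x * g.1 0 0 + y * g.1 1 0) (x * g.1 0 1 + y * g.1 1 1) := by
  obtain ⟨f', -, hf'⟩ := (hα.changeBasis g).exists_hasForm
  refine ⟨f', hf', fun x y => ?_⟩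
  have h1 := hf'.norm_eq x y
  have e : x • changeBasis g.1 α 0 + y • changeBasis g.1 α 1 = (x * g.1 0 0 + y * g.1 1 0) • α 0
      + (x * g.1 0 1 + y * g.1 1 1) • α 1 := by
    simp only [changeBasis, zsmul_eq_mul]; push_cast; ring
  rw [e, h.norm_eq, coordDet_changeBasis, g.det_coe, Int.cast_one, one_mul] at h1
  have := mul_right_cancel₀ hα.det_ne_zero h1
  exact_mod_cast this.symm

/-- The values `f(0, 1)` and `f(1, y)` are first coefficients of forms of other oriented bases. -/
theorem exists_basis_first_coeff {f : BinForm} {α : Fin 2 → QuadAlg D} (h : HasForm f α)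
    {I : OrientedIdeal D} (hα : IsOrientedBasis I α) :
    (∃ f' α', IsOrientedBasis I α' ∧ HasForm f' α' ∧ f'.a = f.c) ∧
    ∀ y, ∃ f' α', IsOrientedBasis I α' ∧ HasForm f' α' ∧ f'.a = f.eval 1 y := by
  constructor
  · let g : SL(2, ℤ) := ⟨!![0, 1; -1, 0], by simp⟩
    obtain ⟨f', hf', he⟩ := h.exists_changeBasis hα g
    refine ⟨f', _, hα.changeBasis g, hf', ?_⟩
    simpa [BinForm.eval, g] using he 1 0
  · intro y
    let g : SL(2, ℤ) := ⟨!![1, y; 0, 1], by simp⟩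
    obtain ⟨f', hf', he⟩ := h.exists_changeBasis hα g
    refine ⟨f', _, hα.changeBasis g, hf', ?_⟩
    simpa [BinForm.eval, g] using he 1 0

/-- The bound for reduced forms. The values `f(1, y)` are needed when `c = 0`, which can happen
only for square discriminants. -/
theorem BinForm.abs_a_le {f : BinForm} (hf : f.disc ≠ 0) (hb : |f.b| ≤ |f.a|)
    (hc : f.c ≠ 0 → |f.a| ≤ |f.c|) (hy : ∀ y, f.eval 1 y ≠ 0 → |f.a| ≤ |f.eval 1 y|) :
    |f.a| ≤ |f.disc| := by
  by_cases hc0 : f.c = 0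
  · have hb0 : f.b ≠ 0 := fun h => hf (by simp [disc, hc0, h])
    have hab : |f.a| ≤ |f.b| := by
      have hm := Int.emod_add_mul_ediv f.a f.b
      by_cases hr : f.a % f.b = 0
      · have e : f.eval 1 (1 - f.a / f.b) = f.b := by
          simp only [eval, hc0]; linear_combination -hm + hr
        have := hy (1 - f.a / f.b)
        rw [e] at this
        exact this hb0
      · have e : f.eval 1 (-(f.a / f.b)) = f.a % f.b := by
          simp only [eval, hc0]; linear_combination -hm
        have := hy (-(f.a / f.b))
        rw [e] at this
        have h1 := Int.emod_nonneg f.a hb0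
        have h2 := Int.emod_lt_abs f.a hb0
        refine (this hr).trans ?_
        rw [abs_of_nonneg h1]; exact h2.le
    have e : |f.disc| = |f.b| * |f.b| := by
      simp only [disc, hc0]; rw [← abs_mul]; congr 1; ring
    rw [e]
    have : 1 ≤ |f.b| := Int.one_le_abs hb0
    nlinarith
  · have h1 := hc hc0
    have h2 : 4 * (|f.a| * |f.c|) ≤ |f.b| * |f.b| + |f.disc| := by
      have e : 4 * (|f.a| * |f.c|) = |f.b ^ 2 - f.disc| := by
        rw [← abs_mul, show f.b ^ 2 - f.disc = 4 * (f.a * f.c) by simp only [disc]; ring,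
          abs_mul 4]; rfl
      rw [e, ← abs_mul, ← sq]
      exact abs_sub _ _
    have h3 := abs_nonneg f.a
    have h4 : |f.a| * |f.a| ≤ |f.a| * |f.c| := mul_le_mul_of_nonneg_left h1 h3
    have h5 : |f.b| * |f.b| ≤ |f.a| * |f.a| := mul_le_mul hb hb (abs_nonneg _) h3
    rcases eq_or_lt_of_le h3 with h6 | h6
    · rw [← h6]; exact abs_nonneg _
    · nlinarith

/-- Every oriented ideal has an oriented basis with a reduced form: take `|a| ≠ 0` minimal among
all oriented bases, and then translate to reduce `b` modulo `2 a`. -/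
theorem OrientedIdeal.exists_reduced (hD0 : D ≠ 0) (hD : D % 4 = 0 ∨ D % 4 = 1)
    (I : OrientedIdeal D) : ∃ f α, IsOrientedBasis I α ∧ HasForm f α ∧ f.a ≠ 0 ∧
      |f.a| ≤ |D| ∧ |f.b| ≤ |D| := by
  classical
  let P : ℕ → Prop := fun n => ∃ f α, IsOrientedBasis I α ∧ HasForm f α ∧ f.a ≠ 0 ∧ f.a.natAbs = n
  have hne : ∃ n, P n := by
    obtain ⟨α, hα⟩ := I.exists_basis
    obtain ⟨f, -, hf⟩ := hα.exists_hasForm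
    have hdisc := hf.disc_eq hD hα.det_ne_zero
    by_cases ha : f.a = 0
    · by_cases hc : f.c = 0
      · obtain ⟨f', α', h1, h2, h3⟩ := (exists_basis_first_coeff hf hα).2 1
        refine ⟨_, f', α', h1, h2, ?_, rfl⟩
        rw [h3]
        simp only [BinForm.eval, ha, hc]
        intro hb
        apply hD0
        rw [← hdisc, BinForm.disc, ha]
        have : f.b = 0 := by linarith
        rw [this]; ring
      · obtain ⟨f', α', h1, h2, h3⟩ := (exists_basis_first_coeff hf hα).1
        exact ⟨_, f', α', h1, h2, by rwa [h3], rfl⟩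
    · exact ⟨_, f, α, hα, hf, ha, rfl⟩
  obtain ⟨f₀, α₀, h1, h2, h3, h4⟩ := Nat.find_spec hne
  have hmin : ∀ f α, IsOrientedBasis I α → HasForm f α → f.a ≠ 0 → |f₀.a| ≤ |f.a| := by
    intro f α hα hf ha
    have := Nat.find_min' hne ⟨f, α, hα, hf, ha, rfl⟩
    rw [← h4] at this
    rw [Int.abs_eq_natAbs, Int.abs_eq_natAbs]
    exact_mod_cast this
  -- Translate so that `|b| ≤ |a|`.
  obtain ⟨k, hk⟩ : ∃ k : ℤ, |f₀.b + 2 * f₀.a * k| ≤ |f₀.a| := by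
    have h5 := Int.emod_nonneg (f₀.b + |f₀.a|) (b := 2 * f₀.a) (by simpa using h3)
    have h6 := Int.emod_lt_abs (f₀.b + |f₀.a|) (b := 2 * f₀.a) (by simpa using h3)
    have h7 := Int.emod_add_mul_ediv (f₀.b + |f₀.a|) (2 * f₀.a)
    rw [abs_mul, abs_two] at h6
    refine ⟨-((f₀.b + |f₀.a|) / (2 * f₀.a)), abs_le.mpr ⟨?_, ?_⟩⟩
    · linarith
    · linarith
  let g : SL(2, ℤ) := ⟨!![1, 0; k, 1], by simp⟩
  obtain ⟨f, hf, he⟩ := h2.exists_changeBasis h1 g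
  have hα := h1.changeBasis g
  have e1 := he 1 0
  have e2 := he 0 1
  have e3 := he 1 1
  simp [BinForm.eval, g] at e1 e2 e3
  have hb : f.b = f₀.b + 2 * f₀.a * k := by linear_combination e3 - e1 - e2
  have hdisc := hf.disc_eq hD hα.det_ne_zero
  have hbf : |f.b| ≤ |f.a| := by rwa [hb, e1]
  have ha : |f.a| ≤ |D| := by
    rw [← hdisc]
    refine BinForm.abs_a_le (by rwa [hdisc]) hbf (fun hc => ?_) (fun y hy => ?_)
    · obtain ⟨f', α', i1, i2, i3⟩ := (exists_basis_first_coeff hf hα).1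
      rw [e1, ← i3]
      exact hmin f' α' i1 i2 (by rwa [i3])
    · obtain ⟨f', α', i1, i2, i3⟩ := (exists_basis_first_coeff hf hα).2 y
      rw [e1, ← i3]
      exact hmin f' α' i1 i2 (by rwa [i3])
  exact ⟨f, _, hα, hf, by rwa [e1], ha, hbf.trans ha⟩

/-- The narrow class is determined by the coefficients `a` and `b` of a reduced form, which are
bounded; `c` follows from the discriminant. -/
theorem finite_narrowClassGroup (hD0 : D ≠ 0) (hD : D % 4 = 0 ∨ D % 4 = 1) :
    Finite (NarrowClassGroup D) := by
  have hsurj : ∀ x : NarrowClassGroup D, ∃ I : OrientedIdeal D, narrowClass I = x :=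
    QuotientGroup.mk_surjective
  choose I hI using hsurj
  choose f α h1 h2 h3 h4 h5 using fun x => (I x).exists_reduced hD0 hD
  let F : NarrowClassGroup D → Set.Icc (-|D|) |D| × Set.Icc (-|D|) |D| := fun x =>
    (⟨(f x).a, abs_le.mp (h4 x)⟩, ⟨(f x).b, abs_le.mp (h5 x)⟩)
  refine Finite.of_injective F fun x y hxy => ?_
  have ha : (f x).a = (f y).a := congrArg (fun p => (p.1 : ℤ)) hxy
  have hb : (f x).b = (f y).b := congrArg (fun p => (p.2 : ℤ)) hxy
  have hc : (f x).c = (f y).c := by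
    have d1 := (h2 x).disc_eq hD (h1 x).det_ne_zero
    have d2 := (h2 y).disc_eq hD (h1 y).det_ne_zero
    rw [BinForm.disc] at d1 d2
    rw [ha, hb] at d1
    have : 4 * (f y).a ≠ 0 := mul_ne_zero (by norm_num) (h3 y)
    apply mul_left_cancel₀ this
    linarith
  have hf : f x = f y := by
    cases hx : f x; cases hy : f y
    simp_all
  rw [← hI x, ← hI y]
  exact narrowClass_eq_of_hasForm hD0 hD (h1 x) (h1 y) (h2 x) (hf ▸ h2 y)

/-! ### Negative discriminants -/

theorem norm_nonneg_of_neg (hD : D % 4 = 0 ∨ D % 4 = 1) (hneg : D < 0) (z : QuadAlg D) :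
    0 ≤ z.norm := by
  have e := cast_disc hD
  have hneg' : (D : ℚ) < 0 := by exact_mod_cast hneg
  rw [norm_def]
  nlinarith [sq_nonneg (2 * z.re + ((D % 4 : ℤ) : ℚ) * z.im), sq_nonneg z.im]

theorem norm_pos_of_ne_zero (hD : D % 4 = 0 ∨ D % 4 = 1) (hneg : D < 0) {z : QuadAlg D}
    (hz : z ≠ 0) : 0 < z.norm := by
  have e := cast_disc hD
  have hneg' : (D : ℚ) < 0 := by exact_mod_cast hneg
  refine lt_of_le_of_ne (norm_nonneg_of_neg hD hneg z) fun h => hz ?_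
  rw [norm_def] at h
  have h1 : (2 * z.re + ((D % 4 : ℤ) : ℚ) * z.im) ^ 2 + (-D) * z.im ^ 2 = 0 := by
    linear_combination -4 * h - z.im ^ 2 * e
  have h2 : z.im = 0 := by
    by_contra hne
    have : 0 < z.im ^ 2 := by positivity
    nlinarith [sq_nonneg (2 * z.re + ((D % 4 : ℤ) : ℚ) * z.im)]
  rw [h2] at h1
  have h3 : z.re = 0 := by simpa using h1
  exact QuadraticAlgebra.ext h3 h2

/-- For `D < 0` every non-zero element of `K` is invertible. -/
theorem isLocalRing_quadAlg (hD : D % 4 = 0 ∨ D % 4 = 1) (hneg : D < 0) :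
    IsLocalRing (QuadAlg D) := by
  have hu : ∀ z : QuadAlg D, z ≠ 0 → IsUnit z := fun z hz =>
    isUnit_of_norm_ne_zero (norm_pos_of_ne_zero hD hneg hz).ne'
  have : Nontrivial (QuadAlg D) := inferInstance
  refine IsLocalRing.of_isUnit_or_isUnit_one_sub_self fun a => ?_
  by_cases ha : a = 0
  · right
    rw [ha, sub_zero]; exact isUnit_one
  · exact Or.inl (hu a ha)

/-- The principal submodule `κ S` for `κ` in `Kˣ`. -/
noncomputable abbrev principalUnit (D : ℤ) :
    (QuadAlg D)ˣ →* (Submodule (QuadRing D) (QuadAlg D))ˣ :=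
  Units.map (Submodule.spanSingleton (QuadRing D)).toMonoidHom

instance (D : ℤ) : (principalUnit D).range.Normal :=
  ⟨fun n hn g => by rwa [mul_comm g, mul_inv_cancel_right]⟩

/-- The invertible submodules of `K` modulo the principal ones. -/
abbrev InvertibleClass (D : ℤ) : Type :=
  (Submodule (QuadRing D) (QuadAlg D))ˣ ⧸ (principalUnit D).range

/-- Both groups are the Picard group of `S`, as the Picard group of the field `K` is trivial. -/
theorem card_invertibleClass (hD : D % 4 = 0 ∨ D % 4 = 1) (hneg : D < 0) [IsDomain (QuadRing D)] :
    Nat.card (InvertibleClass D) = Nat.card (ClassGroup (QuadRing D)) := by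
  have := isLocalRing_quadAlg hD hneg
  have hinj : Function.Injective (algebraMap (QuadRing D) (QuadAlg D)) := by
    intro x y hxy
    rw [algebraMap_quadRing, algebraMap_quadRing] at hxy
    have h1 := congrArg QuadraticAlgebra.re hxy
    have h2 := congrArg QuadraticAlgebra.im hxy
    exact QuadraticAlgebra.ext (Int.cast_injective h1) (Int.cast_injective h2)
  have : FaithfulSMul (QuadRing D) (QuadAlg D) :=
    (faithfulSMul_iff_algebraMap_injective _ _).mpr hinj
  have e1 := Submodule.unitsQuotEquivRelPic (QuadRing D) (QuadAlg D)
  have e2 := ClassGroup.equivPic (QuadRing D)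
  have e3 := (MulEquiv.subgroupCongr
    (CommRing.relPic_eq_top (QuadRing D) (QuadAlg D))).trans Subgroup.topEquiv
  exact Nat.card_congr ((e1.trans e3).trans e2.symm).toEquiv

/-- For `D < 0` the orientation splits off from the narrow class group. -/
theorem exists_narrowClassGroup_equiv (hD : D % 4 = 0 ∨ D % 4 = 1) (hneg : D < 0) :
    ∃ e : NarrowClassGroup D ≃ InvertibleClass D × SignTypeˣ,
      ∀ I : OrientedIdeal D, (e (narrowClass I)).2 = I.2 := by
  let ψ : OrientedIdeal D →* InvertibleClass D × SignTypeˣ :=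
    ((QuotientGroup.mk' (principalUnit D).range).prodMap (MonoidHom.id SignTypeˣ) :
      (Submodule (QuadRing D) (QuadAlg D))ˣ × SignTypeˣ →* InvertibleClass D × SignTypeˣ)
  have hψ : ∀ I, ψ I = (QuotientGroup.mk I.1, I.2) := fun I => rfl
  have hsurj : Function.Surjective ψ := by
    rintro ⟨⟨U⟩, ε⟩
    exact ⟨(U, ε), rfl⟩
  have hsign : ∀ κ : (QuadAlg D)ˣ, (principalOriented D κ).2 = 1 := fun κ => by
    apply Units.ext
    have : 0 < QuadraticAlgebra.norm (κ : QuadAlg D) :=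
      lt_of_le_of_ne (norm_nonneg_of_neg hD hneg _) (norm_ne_zero_of_unit κ).symm
    exact sign_pos this
  have hker : (principalOriented D).range = ψ.ker := by
    ext I
    rw [MonoidHom.mem_ker, hψ]
    constructor
    · rintro ⟨κ, rfl⟩
      refine Prod.ext ?_ (hsign κ)
      exact (QuotientGroup.eq_one_iff _).mpr ⟨κ, rfl⟩
    · intro h
      obtain ⟨κ, hκ⟩ := (QuotientGroup.eq_one_iff _).mp (congrArg Prod.fst h)
      have h2 : I.2 = 1 := congrArg Prod.snd h
      exact ⟨κ, Prod.ext hκ ((hsign κ).trans h2.symm)⟩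
  refine ⟨((QuotientGroup.quotientMulEquivOfEq hker).trans
    (QuotientGroup.quotientKerEquivOfSurjective ψ hsurj)).toEquiv, fun I => rfl⟩

theorem card_signType_units : Nat.card SignTypeˣ = 2 := by
  rw [Nat.card_eq_fintype_card]; decide

/-- The orientation opposite to the sign `s`: it is that of `I` when the form of the slot of `I` is
definite of sign `s`. -/
noncomputable def negSign (s : ℤˣ) : SignTypeˣ :=
  Units.mk0 (-SignType.sign (s : ℤ)) (by rcases Int.units_eq_one_or s with rfl | rfl <;> decide)

/-- For `D < 0` the form of a slot is definite, of sign opposite to the orientation. -/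
theorem CorrespondsTo.isDefinite_iff (hD : D % 4 = 0 ∨ D % 4 = 1) (hneg : D < 0)
    {q : ChargeCube} {I J L : OrientedIdeal D} (h : CorrespondsTo q I J L) (s : ℤˣ) :
    q.formS.IsDefinite s ↔ I.2 = negSign s := by
  obtain ⟨α, hα, hf⟩ := h.exists_hasForm hD
  have h0 : ∀ x y : ℤ, (x, y) ≠ (0, 0) → 0 < (x • α 0 + y • α 1).norm := by
    intro x y hxy
    refine norm_pos_of_ne_zero hD hneg fun h => hxy ?_
    have h1 := congrArg QuadraticAlgebra.re h
    have h2 := congrArg QuadraticAlgebra.im h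
    simp at h1 h2
    have hx : (x : ℚ) = 0 := by
      apply mul_right_cancel₀ hα.det_ne_zero
      simp only [coordDet]
      linear_combination (α 1).im * h1 - (α 1).re * h2
    have hy : (y : ℚ) = 0 := by
      apply mul_right_cancel₀ hα.det_ne_zero
      simp only [coordDet]
      linear_combination (α 0).re * h2 - (α 0).im * h1
    exact Prod.ext (by exact_mod_cast hx) (by exact_mod_cast hy)
  have key : ∀ x y : ℤ, (x, y) ≠ (0, 0) →
      (0 < (s : ℤ) * q.formS.eval x y ↔ I.2 = negSign s) := by
    intro x y hxy
    have h1 := hf.norm_eq x y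
    have h2 := h0 x y hxy
    rw [h1, BinForm.eval_neg] at h2
    push_cast at h2
    have e : I.2 = negSign s ↔ SignType.sign (coordDet α) = -SignType.sign (s : ℤ) := by
      rw [hα.2, Units.ext_iff]; rfl
    rw [e]
    rcases lt_or_gt_of_ne hα.det_ne_zero with hd | hd
    · have h3 : (0 : ℚ) < q.formS.eval x y := by nlinarith
      have h3' : 0 < q.formS.eval x y := by exact_mod_cast h3
      rw [sign_neg hd]
      rcases Int.units_eq_one_or s with rfl | rfl
      · simpa using h3'
      · simpa using h3'.le
    · have h3 : (q.formS.eval x y : ℚ) < 0 := by nlinarith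
      have h3' : q.formS.eval x y < 0 := by exact_mod_cast h3
      rw [sign_pos hd]
      rcases Int.units_eq_one_or s with rfl | rfl
      · simpa using h3'.le
      · simpa using h3'
  constructor
  · intro hs
    exact (key 1 0 (by simp)).mp (hs 1 0 (by simp))
  · intro hI x y hxy
    exact (key x y hxy).mpr hI

theorem negSign_mul (s t : ℤˣ) : (negSign s * negSign t)⁻¹ = negSign (-(s * t)) := by
  apply Units.ext
  rcases Int.units_eq_one_or s with rfl | rfl <;> rcases Int.units_eq_one_or t with rfl | rfl <;>
    decide

theorem exists_negSign (ε : SignTypeˣ) : ∃ s : ℤˣ, ε = negSign s := by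
  rcases (by decide : ∀ ε : SignTypeˣ, ε = 1 ∨ ε = -1) ε with rfl | rfl
  · exact ⟨-1, by apply Units.ext; decide⟩
  · exact ⟨1, by apply Units.ext; decide⟩

/-- The sign of the third form is determined by the other two: the product of the orientations
is `1`, and each sign is opposite to an orientation. -/
theorem CorrespondsTo.isDefinite_all (hD : D % 4 = 0 ∨ D % 4 = 1) (hneg : D < 0)
    {q : ChargeCube} {I J L : OrientedIdeal D} (h : CorrespondsTo q I J L) (s t : ℤˣ) :
    (q.formS.IsDefinite s ∧ q.formT.IsDefinite t ∧ q.formU.IsDefinite (-(s * t))) ↔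
      I.2 = negSign s ∧ J.2 = negSign t := by
  have hT := (h.swapST hD).isDefinite_iff hD hneg t
  have hU := (h.swapSU hD).isDefinite_iff hD hneg (-(s * t))
  rw [ChargeCube.formS_swapST] at hT
  rw [ChargeCube.formS_swapSU] at hU
  rw [h.isDefinite_iff hD hneg, hT, hU]
  constructor
  · rintro ⟨h1, h2, -⟩; exact ⟨h1, h2⟩
  · rintro ⟨h1, h2⟩
    refine ⟨h1, h2, ?_⟩
    have h3 : I.2 * J.2 * L.2 = 1 := congrArg Prod.snd (h.mul_eq_one hD)
    rw [← negSign_mul, ← h1, ← h2]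
    exact eq_inv_of_mul_eq_one_right h3

/-- The number of classes with a given pattern of signs. -/
theorem card_signPattern (hD0 : D ≠ 0) (hD : D % 4 = 0 ∨ D % 4 = 1) (hneg : D < 0)
    (e : CubeClass D ≃ NarrowClassGroup D × NarrowClassGroup D)
    (he : ∀ (q : ProjCube D) (I J L : OrientedIdeal D), CorrespondsTo q.1 I J L →
      e (CubeClass.mk q) = (narrowClass I, narrowClass J)) (s t : ℤˣ) :
    Nat.card {x : CubeClass D // ∃ q : ProjCube D, CubeClass.mk q = x ∧
      q.1.formS.IsDefinite s ∧ q.1.formT.IsDefinite t ∧ q.1.formU.IsDefinite (-(s * t))} =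
      Nat.card (InvertibleClass D) ^ 2 := by
  obtain ⟨φ, hφ⟩ := exists_narrowClassGroup_equiv hD hneg
  let F : CubeClass D ≃ (InvertibleClass D × SignTypeˣ) × (InvertibleClass D × SignTypeˣ) :=
    e.trans (φ.prodCongr φ)
  have hF : ∀ (q : ProjCube D) (I J L : OrientedIdeal D), CorrespondsTo q.1 I J L →
      (F (CubeClass.mk q)).1.2 = I.2 ∧ (F (CubeClass.mk q)).2.2 = J.2 := by
    intro q I J L h
    have : F (CubeClass.mk q) = (φ (narrowClass I), φ (narrowClass J)) := by
      simp only [F, Equiv.trans_apply, he q I J L h]; rfl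
    rw [this]
    exact ⟨hφ I, hφ J⟩
  have hiff : ∀ x : CubeClass D, (∃ q : ProjCube D, CubeClass.mk q = x ∧
      q.1.formS.IsDefinite s ∧ q.1.formT.IsDefinite t ∧ q.1.formU.IsDefinite (-(s * t))) ↔
      (F x).1.2 = negSign s ∧ (F x).2.2 = negSign t := by
    intro x
    constructor
    · rintro ⟨q, rfl, hq⟩
      obtain ⟨I, J, L, h⟩ := exists_triple hD0 hD q
      rw [(hF q I J L h).1, (hF q I J L h).2]
      exact (h.isDefinite_all hD hneg s t).mp hq
    · obtain ⟨q, rfl⟩ : ∃ q, CubeClass.mk q = x := Quotient.exists_rep x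
      intro hx
      obtain ⟨I, J, L, h⟩ := exists_triple hD0 hD q
      rw [(hF q I J L h).1, (hF q I J L h).2] at hx
      exact ⟨q, rfl, (h.isDefinite_all hD hneg s t).mpr hx⟩
  let G : {p : (InvertibleClass D × SignTypeˣ) × (InvertibleClass D × SignTypeˣ) //
      p.1.2 = negSign s ∧ p.2.2 = negSign t} ≃ InvertibleClass D × InvertibleClass D :=
    { toFun := fun p => (p.1.1.1, p.1.2.1)
      invFun := fun p => ⟨((p.1, negSign s), (p.2, negSign t)), rfl, rfl⟩
      left_inv := by rintro ⟨p, h, h'⟩; simp only [← h, ← h']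
      right_inv := fun _ => rfl }
  rw [Nat.card_congr ((F.subtypeEquiv hiff).trans G), Nat.card_prod, sq]

end

theorem mainTheorem2 (D : ℤ) (hD0 : D ≠ 0) (hD : D % 4 = 0 ∨ D % 4 = 1) :
    (∃ (_ : CommGroup (CubeClass D))
        (e : CubeClass D ≃* NarrowClassGroup D × NarrowClassGroup D),
      (∃ h : (idCube D).quarticNorm = -D ∧ (idCube D).IsProjective,
        CubeClass.mk (⟨idCube D, h⟩ : ProjCube D) = 1) ∧
      (∀ q : ProjCube D, ∃ I J L : OrientedIdeal D, CorrespondsTo q.1 I J L) ∧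
      (∀ I J L : OrientedIdeal D, IsBalanced I J L →
        ∃ q : ProjCube D, CorrespondsTo q.1 I J L) ∧
      (∀ (q : ProjCube D) (I J L : OrientedIdeal D), CorrespondsTo q.1 I J L →
        e (CubeClass.mk q) = (narrowClass I, narrowClass J) ∧
        narrowClass L = (narrowClass I * narrowClass J)⁻¹) ∧
      (∀ (q q' : ProjCube D) (I J L I' J' L' : OrientedIdeal D),
        CorrespondsTo q.1 I J L → CorrespondsTo q'.1 I' J' L' →
        ∃ q'' : ProjCube D, CorrespondsTo q''.1 (I * I') (J * J') (L * L') ∧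
          CubeClass.mk q * CubeClass.mk q' = CubeClass.mk q'')) ∧
    Finite (CubeClass D) ∧
    Nat.card (CubeClass D) = Nat.card (NarrowClassGroup D) ^ 2 ∧
    (∀ hneg : D < 0,
      haveI : IsDomain (QuadRing D) := quadRing_isDomain hD hneg
      Nat.card (NarrowClassGroup D) = 2 * Nat.card (ClassGroup (QuadRing D)) ∧
      Nat.card (CubeClass D) = 4 * Nat.card (ClassGroup (QuadRing D)) ^ 2 ∧
      (∀ q : ProjCube D, ∃ s t : ℤˣ, q.1.formS.IsDefinite s ∧ q.1.formT.IsDefinite t ∧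
        q.1.formU.IsDefinite (-(s * t))) ∧
      ∀ s t : ℤˣ,
        Nat.card {x : CubeClass D // ∃ q : ProjCube D, CubeClass.mk q = x ∧
            q.1.formS.IsDefinite s ∧ q.1.formT.IsDefinite t ∧
            q.1.formU.IsDefinite (-(s * t))} =
          Nat.card (ClassGroup (QuadRing D)) ^ 2) := by
  obtain ⟨e₀, he₀⟩ := exists_cubeClass_equiv hD0 hD
  let _ : CommGroup (CubeClass D) := e₀.commGroup
  have hfin := finite_narrowClassGroup hD0 hD
  have hcard : Nat.card (CubeClass D) = Nat.card (NarrowClassGroup D) ^ 2 := by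
    rw [Nat.card_congr e₀, Nat.card_prod, sq]
  refine ⟨⟨e₀.commGroup, e₀.mulEquiv, ?_, exists_triple hD0 hD, ?_, ?_, ?_⟩,
    Finite.of_equiv _ e₀.symm, hcard, ?_⟩
  · have h := idCube_correspondsTo hD
    refine ⟨h.proj hD, e₀.injective ?_⟩
    exact (he₀ _ _ _ _ h).trans (map_one e₀.mulEquiv).symm
  · intro I J L h
    exact exists_projCube hD ((isBalanced_iff hD).mp h)
  · intro q I J L h
    refine ⟨he₀ q I J L h, ?_⟩
    rw [← narrowClass_mul, eq_inv_iff_mul_eq_one, ← narrowClass_mul, mul_comm L, h.mul_eq_one hD]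
    rfl
  · intro q q' I J L I' J' L' h h'
    have h1 : (I * I') * (J * J') * (L * L') = 1 := by
      calc (I * I') * (J * J') * (L * L') = (I * J * L) * (I' * J' * L') := by ac_rfl
        _ = 1 := by rw [h.mul_eq_one hD, h'.mul_eq_one hD, one_mul]
    obtain ⟨q'', h''⟩ := exists_projCube hD h1
    refine ⟨q'', h'', e₀.injective ?_⟩
    refine (map_mul e₀.mulEquiv _ _).trans ?_
    change e₀ _ * e₀ _ = e₀ _
    rw [he₀ _ _ _ _ h, he₀ _ _ _ _ h', he₀ _ _ _ _ h'']
    rfl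
  · intro hneg
    have : IsDomain (QuadRing D) := quadRing_isDomain hD hneg
    obtain ⟨φ, -⟩ := exists_narrowClassGroup_equiv hD hneg
    have h2 : Nat.card (NarrowClassGroup D) = 2 * Nat.card (ClassGroup (QuadRing D)) := by
      rw [Nat.card_congr φ, Nat.card_prod, card_signType_units, card_invertibleClass hD hneg,
        mul_comm]
    refine ⟨h2, by rw [hcard, h2]; ring, fun q => ?_, fun s t => ?_⟩
    · obtain ⟨I, J, L, h⟩ := exists_triple hD0 hD q
      obtain ⟨s, hs⟩ := exists_negSign I.2
      obtain ⟨t, ht⟩ := exists_negSign J.2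
      exact ⟨s, t, (h.isDefinite_all hD hneg s t).mpr ⟨hs, ht⟩⟩
    · rw [card_signPattern hD0 hD hneg e₀ he₀ s t, card_invertibleClass hD hneg]
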